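/- Theorem 3.1. Let $X$ be a compact cobordism of manifolds with boundary, from $X_-$ to $X_+$: $X$ is a compact Hausdorff smooth manifold with corners, $X_-$ and $X_+$ are disjoint closed subsets of $\partial X$, $B=\overline{\partial X\setminus (X_-\cup X_+)}$, and each of $X_-$, $B$, $X_+$ is a smooth hypersurface in $\partial X$ (locally one boundary hyperplane of a chart), so that the only corners are the points of $B\cap(X_-\cup X_+)$. Let $\pi\colon X\to[s_-,s_+]$ be a tame function, i.e. a smooth function such that $\pi$ is submersive, $X_-=\pi^{-1}(s_-)$, $X_+=\pi^{-1}(s_+)$, and the critical points of $\pi|_B$ are isolated and have distinct critical values, all in the open interval $(s_-,s_+)$. Let $s_-=s_0<s_1<\dots<s_n=s_+$ be a partition such that each $\pi^{-1}([s_i,s_{i+1}])$ contains at most one critical point of $\pi|_B$. Put $X_i=\pi^{-1}(s_i)$ and $X_i^{i+1}=\pi^{-1}([s_i,s_{i+1}])$, and let $ZX$ be the diagram of inclusions $$X_0\to X_0^1\leftarrow X_1\to X_1^2\leftarrow\cdots\leftarrow X_n .$$ Let $\Gamma\pi$ be the space of continuous sections of $\pi$ with the compact-open topology, and let $\pi_0$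 denote the set of path components. Then there is a short exact sequence of sets $$*\to R^1\lim\pi_1(ZX)\to\pi_0\Gamma\pi\to\lim\pi_0(ZX)\to *$$ in the following sense. (a) The natural map $\Phi\colon\pi_0\Gamma\pi\to\lim\pi_0(ZX)$, which sends the class of $\sigma$ to the classes of the points $\sigma(s_i)$, is surjective. (b) Let $\gamma$ consist of points $x_i\in X_i$ and paths $p_i$ in $X_i^{i+1}$ from $x_i$ to $x_{i+1}$; every element of $\lim\pi_0(ZX)$ is the class $[\gamma]$ of some such $\gamma$. Let $\pi_1(ZX,\gamma)$ be the diagram of the groups $\pi_1(X_i,x_i)$ and $\pi_1(X_i^{i+1},x_i)$ with the maps $\alpha_i\colon\pi_1(X_i,x_i)\to\pi_1(X_i^{i+1},x_i)$ induced by inclusion and the maps $\beta_i\colon\pi_1(X_{i+1},x_{i+1})\to\pi_1(X_i^{i+1},x_{i+1})\cong\pi_1(X_i^{i+1},x_i)$ given by inclusion and transport along $p_i$. Then there is an injective map $\iota\colon R^1\lim\pi_1(ZX,\gamma)\to\pi_0\Gamma\pi$ with image $\Phi^{-1}([\gamma])$. Here, for a diagram $F$ of groups, $R^1\lim F$ is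 the set of families $z_f\in F(b)$, indexed by the arrows $f\colon a\to b$, with $z_{gf}=z_g\cdot F(g)(z_f)$, modulo the action $(h\cdot z)_f=h_b\,z_f\,F(f)(h_a)^{-1}$ of $\prod_a F(a)$. Moreover, with the product in $\pi_1$ written so that $gh$ means first $h$, then $g$, let $\prod_{i=0}^n\pi_1(X_i,x_i)$ act on $\prod_{i=0}^{n-1}\pi_1(X_i^{i+1},x_i)$ by $(g\cdot h)_i=\beta_i(g_{i+1})\,h_i\,\alpha_i(g_i)^{-1}$. Then $z\mapsto(z_{\beta_i}^{-1}z_{\alpha_i})_i$, where $z_{\alpha_i}$ and $z_{\beta_i}$ are the values of $z$ at the arrows $X_i\to X_i^{i+1}$ and $X_{i+1}\to X_i^{i+1}$, induces a bijection $o$ from $R^1\lim\pi_1(ZX,\gamma)$ onto the orbit set of this action. The map $\iota$ can be chosen so that, for every section $\sigma$, all paths $q_i$ in $X_i$ from $x_i$ to $\sigma(s_i)$ and every $x\in R^1\lim\pi_1(ZX,\gamma)$, one has $\iota(x)=[\sigma]$ if and only if $o(x)$ is the orbit of the family of loops that run along $q_i$, then along $\sigma|_{[s_i,s_{i+1}]}$,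 then back along $q_{i+1}$ and back along $p_i$. -/

import Mathlib

open Set Filter Topology CategoryTheory
open scoped Manifold ContDiff

universe u

noncomputable section

/-! ### Compact cobordisms of manifolds with boundary and tame functions

A cobordism of manifolds with boundary of dimension `d` is a smooth manifold with corners, charted
on the quadrants `{x ∈ ℝᵈ | 0 ≤ xᵢ}`; at a given point only the coordinates that vanish there are
boundary coordinates. -/

section Tame

variable (d : ℕ) {X : Type u} [TopologicalSpace X] [ChartedSpace (EuclideanQuadrant d) X]

/-- The `i`-th coordinate function of the preferred chart at `p`. -/
def chartCoord (p : X) (i : Fin d) (q : X) : ℝ :=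
  extChartAt (modelWithCornersEuclideanQuadrant d) p q i

/-- Near `p`, the set `F` is the zero set of the `i`-th coordinate of the quadrant. -/
def IsFaceAt (F : Set X) (p : X) (i : Fin d) : Prop :=
  ∀ᶠ q in 𝓝 p, q ∈ F ↔ chartCoord d p i q = 0

/-- `F` is a smooth hypersurface in the boundary: near each of its points it is one boundary
hyperplane of the quadrant.  Such an `F` is itself a manifold of dimension `d - 1` with corners. -/
def IsBoundaryFace (F : Set X) : Prop :=
  ∀ p ∈ F, ∃ i, IsFaceAt d F p i

/-- The side `B` of a cobordism from `Xm` to `Xp`: the closure of what the two ends leave of the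
boundary, so that `B` contains `∂Xm` and `∂Xp`. -/
def sideBoundary (Xm Xp : Set X) : Set X :=
  closure ((modelWithCornersEuclideanQuadrant d).boundary X \ (Xm ∪ Xp))

/-- `X` is a cobordism from `Xm` to `Xp`: the two ends are disjoint, and the ends and the side `B`
are smooth hypersurfaces in `∂X`, which hence is `Xm ∪ B ∪ Xp`.  Every boundary hyperplane at a
point lies locally in an end or in `B`, and each of these is locally a single hyperplane; so there
are at most two of them, and exactly two at the points where `B` meets `Xm` or `Xp`. -/
structure IsCobordism (Xm Xp : Set X) : Prop where
  isClosed_bot : IsClosed Xm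
  isClosed_top : IsClosed Xp
  disjoint : Disjoint Xm Xp
  face_bot : IsBoundaryFace d Xm
  face_top : IsBoundaryFace d Xp
  face_side : IsBoundaryFace d (sideBoundary d Xm Xp)

/-- `p` is a critical point of the restriction of `f` to the hypersurface `F` in `∂X`: it lies on
`F`, and `df` vanishes on the tangent space `{v | vᵢ = 0}` of `F` at `p`. -/
def IsCriticalOn (F : Set X) (f : X → ℝ) (p : X) : Prop :=
  p ∈ F ∧ ∃ i, IsFaceAt d F p i ∧
    ∀ v : EuclideanSpace ℝ (Fin d), v i = 0 →
      mfderiv (modelWithCornersEuclideanQuadrant d) 𝓘(ℝ, ℝ) f p v = (0 : ℝ)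

/-- Tame functions `f : X → [sm, sp]` on a cobordism from `Xm` to `Xp`. -/
structure IsTame (Xm Xp : Set X) (sm sp : ℝ) (f : X → ℝ) : Prop where
  isCobordism : IsCobordism d Xm Xp
  mem_Icc : ∀ p, f p ∈ Icc sm sp
  contMDiff : ContMDiff (modelWithCornersEuclideanQuadrant d) 𝓘(ℝ, ℝ) ∞ f
  isolated : ∀ p, IsCriticalOn d (sideBoundary d Xm Xp) f p →
    ∀ᶠ q in 𝓝[≠] p, ¬ IsCriticalOn d (sideBoundary d Xm Xp) f q
  injOn : InjOn f {p | IsCriticalOn d (sideBoundary d Xm Xp) f p}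
  criticalValue_mem : ∀ p, IsCriticalOn d (sideBoundary d Xm Xp) f p → f p ∈ Ioo sm sp
  submersive : ∀ p, Function.Surjective
    (mfderiv (modelWithCornersEuclideanQuadrant d) 𝓘(ℝ, ℝ) f p)
  bot_eq : Xm = f ⁻¹' {sm}
  top_eq : Xp = f ⁻¹' {sp}

end Tame

/-! ### The shape of the diagram `ZX` -/

/-- Objects of the category `• → • ← • → ⋯ ← •` with `n + 1` sources and `n` targets. -/
inductive Zigzag (n : ℕ) : Type
  | pt (i : Fin (n + 1)) : Zigzag n
  | seg (i : Fin n) : Zigzag n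

namespace Zigzag

/-- Besides identities, there is one arrow from each endpoint of a segment to that segment. -/
inductive Hom {n : ℕ} : Zigzag n → Zigzag n → Type
  | id (a : Zigzag n) : Hom a a
  | left (i : Fin n) : Hom (.pt i.castSucc) (.seg i)
  | right (i : Fin n) : Hom (.pt i.succ) (.seg i)

/-- Composition; at least one of two composable arrows is an identity. -/
def Hom.comp {n : ℕ} : {a b c : Zigzag n} → Hom a b → Hom b c → Hom a c
  | _, _, _, .id _, g => g
  | _, _, _, .left i, .id _ => .left i
  | _, _, _, .right i, .id _ => .right i

instance category (n : ℕ) : SmallCategory (Zigzag n) where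
  Hom := Hom
  id := Hom.id
  comp := Hom.comp
  id_comp _ := rfl
  comp_id {a b} f := by
    change Hom a b at f
    cases f <;> rfl
  assoc {a b c d} f g h := by
    change Hom a b at f
    change Hom b c at g
    change Hom c d at h
    cases f <;> cases g <;> cases h <;> rfl

/-- The arrow from the left endpoint of the `i`-th segment. -/
def left {n : ℕ} (i : Fin n) : (pt i.castSucc : Zigzag n) ⟶ seg i := Hom.left i

/-- The arrow from the right endpoint of the `i`-th segment. -/
def right {n : ℕ} (i : Fin n) : (pt i.succ : Zigzag n) ⟶ seg i := Hom.right i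

variable {n : ℕ} {C : Type*} [Category C]

/-- The action on arrows of the diagram `diagram A B l r`. -/
def diagramMap {A : Fin (n + 1) → C} {B : Fin n → C}
    (l : ∀ i : Fin n, A i.castSucc ⟶ B i) (r : ∀ i : Fin n, A i.succ ⟶ B i) :
    {a b : Zigzag n} → Hom a b →
      ((Zigzag.rec A B a : C) ⟶ (Zigzag.rec A B b : C))
  | _, _, .id _ => 𝟙 _
  | _, _, .left i => l i
  | _, _, .right i => r i

/-- The diagram `A 0 → B 0 ← A 1 → B 1 ← ⋯ ← A n` given by arrows
`l i : A i → B i` and `r i : A (i + 1) → B i`. -/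
def diagram (A : Fin (n + 1) → C) (B : Fin n → C)
    (l : ∀ i : Fin n, A i.castSucc ⟶ B i) (r : ∀ i : Fin n, A i.succ ⟶ B i) :
    Zigzag n ⥤ C where
  obj a := Zigzag.rec A B a
  map f := diagramMap l r f
  map_id _ := rfl
  map_comp {a b c} f g := by
    change Hom a b at f
    change Hom b c at g
    cases f <;> cases g <;>
      first
        | exact (Category.id_comp _).symm
        | exact (Category.comp_id _).symm

end Zigzag

/-! ### The first derived limit of a diagram of groups -/

section DerivedLimit

variable {C : Type} [SmallCategory C] (F : C ⥤ GrpCat.{u})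

/-- One-cocycles of the cosimplicial replacement of a diagram of (not necessarily abelian)
groups. -/
def LimCocycle : Type u :=
  {z : ∀ (a b : C), (a ⟶ b) → F.obj b //
    ∀ (a b c : C) (f : a ⟶ b) (g : b ⟶ c), z a c (f ≫ g) = z b c g * F.map g (z a b f)}

/-- Two cocycles are cohomologous if they differ by the action of `∏ F a` given by
`(h • z) f = h b * z f * (F f (h a))⁻¹` for `f : a ⟶ b`. -/
def limCocycleSetoid : Setoid (LimCocycle F) where
  r z w := ∃ h : ∀ a, F.obj a, ∀ (a b : C) (f : a ⟶ b),
    w.1 a b f = h b * z.1 a b f * (F.map f (h a))⁻¹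
  iseqv :=
    { refl := fun z => ⟨fun _ => 1, fun a b f => by simp⟩
      symm := by
        rintro z w ⟨h, hh⟩
        exact ⟨fun a => (h a)⁻¹, fun a b f => by rw [hh]; simp [mul_assoc]⟩
      trans := by
        rintro z w v ⟨h, hh⟩ ⟨k, hk⟩
        exact ⟨fun a => k a * h a, fun a b f => by rw [hk, hh]; simp [mul_assoc]⟩ }

/-- `R¹lim F`, the first (nonabelian) derived limit of a diagram of groups. -/
def DerivedLim : Type u := Quotient (limCocycleSetoid F)

/-- The class of a cocycle in `R¹lim F`. -/
def DerivedLim.mk (z : LimCocycle F) : DerivedLim F := Quotient.mk (limCocycleSetoid F) z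

end DerivedLimit

section GluingAction

variable {n : ℕ} (F : Zigzag n ⥤ GrpCat.{u})

/-- For a diagram of groups `G 0 → H 0 ← G 1 → ⋯ ← G n`, the action of `∏ G i` on `∏ H i` by
`(g • h) i = r (g (i + 1)) * h i * (l (g i))⁻¹`. -/
@[reducible]
def gluingAction : MulAction (∀ i : Fin (n + 1), F.obj (.pt i)) (∀ i : Fin n, F.obj (.seg i)) where
  smul g h := fun i =>
    F.map (Zigzag.right i) (g i.succ) * h i * (F.map (Zigzag.left i) (g i.castSucc))⁻¹
  one_smul h := by
    funext i
    change F.map (Zigzag.right i) 1 * h i * (F.map (Zigzag.left i) 1)⁻¹ = h i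
    simp
  mul_smul g g' h := by
    funext i
    change F.map (Zigzag.right i) (g i.succ * g' i.succ) * h i *
        (F.map (Zigzag.left i) (g i.castSucc * g' i.castSucc))⁻¹ =
      F.map (Zigzag.right i) (g i.succ) *
        (F.map (Zigzag.right i) (g' i.succ) * h i * (F.map (Zigzag.left i) (g' i.castSucc))⁻¹) *
        (F.map (Zigzag.left i) (g i.castSucc))⁻¹
    simp [mul_assoc]

/-- The set of orbits of `gluingAction`. -/
def GluingOrbits : Type u :=
  @MulAction.orbitRel.Quotient (∀ i : Fin (n + 1), F.obj (.pt i)) (∀ i : Fin n, F.obj (.seg i))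
    _ (gluingAction F)

/-- The orbit of an element of `∏ H i`. -/
def GluingOrbits.mk (h : ∀ i : Fin n, F.obj (.seg i)) : GluingOrbits F :=
  Quotient.mk (@MulAction.orbitRel _ _ _ (gluingAction F)) h

end GluingAction

/-! ### Path components -/

/-- The functor `π₀` of path components. -/
def piZero : TopCat.{u} ⥤ Type u where
  obj Y := ZerothHomotopy Y
  map {Y Z} f := TypeCat.ofHom (ZerothHomotopy.lift (fun y : Y => ZerothHomotopy.mk (f y))
    (fun _ _ p => ZerothHomotopy.sound (p.map f.hom.continuous)))
  map_id Y := by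
    ext x
    induction x using ZerothHomotopy.rec
    rfl
  map_comp f g := by
    ext x
    induction x using ZerothHomotopy.rec
    rfl

/-! ### Partitions, fibres, and the diagram `ZX` -/

/-- A partition `a = s 0 < s 1 < ⋯ < s n = b`. -/
structure IntervalPartition (a b : ℝ) (n : ℕ) where
  s : Fin (n + 1) → ℝ
  strictMono : StrictMono s
  first : s 0 = a
  last : s (Fin.last n) = b

theorem IntervalPartition.mem_Icc {a b : ℝ} {n : ℕ} (P : IntervalPartition a b n)
    (i : Fin (n + 1)) : P.s i ∈ Icc a b :=
  ⟨P.first.symm.trans_le (P.strictMono.monotone (Fin.zero_le i)),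
    (P.strictMono.monotone (Fin.le_last i)).trans_eq P.last⟩

/-- The piece `[s i, s (i + 1)]` of a partition. -/
def IntervalPartition.piece {a b : ℝ} {n : ℕ} (P : IntervalPartition a b n) (i : Fin n) : Set ℝ :=
  Icc (P.s i.castSucc) (P.s i.succ)

/-- The affine parametrization of the piece `[s i, s (i + 1)]` by the unit interval. -/
def IntervalPartition.param {a b : ℝ} {n : ℕ} (P : IntervalPartition a b n) (i : Fin n) (t : unitInterval) :
    ℝ :=
  (1 - (t : ℝ)) * P.s i.castSucc + t * P.s i.succ

theorem IntervalPartition.param_mem_piece {a b : ℝ} {n : ℕ} (P : IntervalPartition a b n)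
    (i : Fin n) (t : unitInterval) : P.param i t ∈ P.piece i := by
  have h := (P.strictMono (Fin.castSucc_lt_succ (i := i))).le
  have h0 := t.2.1
  have h1 := t.2.2
  constructor <;> simp only [IntervalPartition.param] <;> nlinarith

theorem IntervalPartition.piece_subset {a b : ℝ} {n : ℕ} (P : IntervalPartition a b n)
    (i : Fin n) : P.piece i ⊆ Icc a b :=
  Icc_subset_Icc (P.mem_Icc _).1 (P.mem_Icc _).2

section Sections

variable {X : Type u} [TopologicalSpace X] {a b : ℝ} {n : ℕ}

/-- The space `Γf` of sections of `f : X → [a, b]`, with the compact-open topology. -/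
abbrev SectionSpace (f : X → ℝ) (a b : ℝ) : Type u :=
  {σ : C(Icc a b, X) // ∀ t, f (σ t) = t}

/-- The fibre `Xᵢ` over `s i`. -/
abbrev Fiber (f : X → ℝ) (P : IntervalPartition a b n) (i : Fin (n + 1)) : Type u :=
  {p : X // f p = P.s i}

/-- The preimage `Xᵢⁱ⁺¹` of `[s i, s (i + 1)]`. -/
abbrev Slab (f : X → ℝ) (P : IntervalPartition a b n) (i : Fin n) : Type u :=
  {p : X // f p ∈ P.piece i}

/-- The inclusion of the fibre over `s i` into the preimage of `[s i, s (i + 1)]`. -/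
def inclLeft (f : X → ℝ) (P : IntervalPartition a b n) (i : Fin n) :
    C(Fiber f P i.castSucc, Slab f P i) where
  toFun p := ⟨p.1, p.2.ge, p.2.le.trans (P.strictMono (Fin.castSucc_lt_succ (i := i))).le⟩
  continuous_toFun := by fun_prop

/-- The inclusion of the fibre over `s (i + 1)` into the preimage of `[s i, s (i + 1)]`. -/
def inclRight (f : X → ℝ) (P : IntervalPartition a b n) (i : Fin n) :
    C(Fiber f P i.succ, Slab f P i) where
  toFun p := ⟨p.1, (P.strictMono (Fin.castSucc_lt_succ (i := i))).le.trans p.2.ge, p.2.le⟩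
  continuous_toFun := by fun_prop

/-- The diagram `ZX : X₀ → X₀¹ ← X₁ → X₁² ← ⋯ ← Xₙ`. -/
def ZX (f : X → ℝ) (P : IntervalPartition a b n) : Zigzag n ⥤ TopCat.{u} :=
  Zigzag.diagram (fun i => TopCat.of (Fiber f P i)) (fun i => TopCat.of (Slab f P i))
    (fun i => TopCat.ofHom (inclLeft f P i)) (fun i => TopCat.ofHom (inclRight f P i))

/-- The set `lim π₀(ZX)`. -/
abbrev LimPiZero (f : X → ℝ) (P : IntervalPartition a b n) : Type u :=
  (ZX f P ⋙ piZero).sections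

/-- A point of the homotopy limit of `ZX`: points `xᵢ ∈ Xᵢ`, and paths in `Xᵢⁱ⁺¹` from `xᵢ` to
`xᵢ₊₁`. -/
structure SequentialPath (f : X → ℝ) (P : IntervalPartition a b n) where
  pt : ∀ i, Fiber f P i
  path : ∀ i : Fin n, Path (inclLeft f P i (pt i.castSucc)) (inclRight f P i (pt i.succ))

namespace SequentialPath

variable {f : X → ℝ} {P : IntervalPartition a b n}

/-- The path components of the points of a sequential path, as an element of `lim π₀(ZX)`. -/
def toLim (γ : SequentialPath f P) : LimPiZero f P :=
  ⟨fun c => match c with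
    | .pt i => ZerothHomotopy.mk (γ.pt i)
    | .seg i => ZerothHomotopy.mk (inclLeft f P i (γ.pt i.castSucc)), by
    intro c c' φ
    change Zigzag.Hom c c' at φ
    cases φ with
    | id =>
      change ((ZX f P ⋙ piZero).map (𝟙 c)) _ = _
      rw [CategoryTheory.Functor.map_id]
      rfl
    | left i => rfl
    | right i => exact ZerothHomotopy.sound (γ.path i).symm⟩

/-- The diagram `π₁(ZX, γ)`: the fibre `Xᵢ` and the preimage `Xᵢⁱ⁺¹` are based at `xᵢ`, and the
map from `π₁(Xᵢ₊₁, xᵢ₊₁)` to `π₁(Xᵢⁱ⁺¹, xᵢ)` is transported along the path of `γ` from `xᵢ` to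
`xᵢ₊₁`. -/
def piOne (γ : SequentialPath f P) : Zigzag n ⥤ GrpCat.{u} :=
  Zigzag.diagram
    (fun i => GrpCat.of (FundamentalGroup (Fiber f P i) (γ.pt i)))
    (fun i => GrpCat.of (FundamentalGroup (Slab f P i) (inclLeft f P i (γ.pt i.castSucc))))
    (fun i => GrpCat.ofHom (FundamentalGroup.map (inclLeft f P i) (γ.pt i.castSucc)))
    (fun i => GrpCat.ofHom
      ((FundamentalGroup.fundamentalGroupMulEquivOfPath (γ.path i).symm).toMonoidHom.comp
        (FundamentalGroup.map (inclRight f P i) (γ.pt i.succ))))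

/-- The loops in `Xᵢⁱ⁺¹` by which `δ` differs from `γ`, relative to paths `qᵢ` in `Xᵢ` from the
points of `γ` to those of `δ`: go along `qᵢ`, along `δ`, back along `qᵢ₊₁` and back along `γ`. -/
def difference (γ δ : SequentialPath f P) (q : ∀ i, Path (γ.pt i) (δ.pt i)) (i : Fin n) :
    γ.piOne.obj (.seg i) :=
  FundamentalGroup.fromPath (Path.Homotopic.Quotient.mk
    (((((q i.castSucc).map (inclLeft f P i).continuous).trans (δ.path i)).trans
      ((q i.succ).map (inclRight f P i).continuous).symm).trans (γ.path i).symm))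

/-- The sequential path given by a section: its values at the points of the partition and its
restrictions to the pieces. -/
def ofSection (σ : SectionSpace f a b) : SequentialPath f P where
  pt i := ⟨σ.1 ⟨P.s i, P.mem_Icc i⟩, σ.2 _⟩
  path i :=
    { toFun := fun t => ⟨σ.1 ⟨P.param i t, P.piece_subset i (P.param_mem_piece i t)⟩, by
        rw [σ.2]; exact P.param_mem_piece i t⟩
      continuous_toFun := by
        refine Continuous.subtype_mk (σ.1.continuous.comp (Continuous.subtype_mk ?_ _)) _
        unfold IntervalPartition.param
        fun_prop
      source' := by
        apply Subtype.ext
        simp [IntervalPartition.param, inclLeft]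
      target' := by
        apply Subtype.ext
        simp [IntervalPartition.param, inclRight] }

end SequentialPath

/-- The natural map `π₀ Γf → lim π₀(ZX)`. -/
def sectionsToLim (f : X → ℝ) (P : IntervalPartition a b n) :
    ZerothHomotopy (SectionSpace f a b) → LimPiZero f P :=
  ZerothHomotopy.lift (fun σ => (SequentialPath.ofSection σ : SequentialPath f P).toLim) (by
    intro σ τ p
    have key : ∀ i : Fin (n + 1),
        Joined ((SequentialPath.ofSection σ : SequentialPath f P).pt i)
          ((SequentialPath.ofSection τ : SequentialPath f P).pt i) := fun i =>
      ⟨p.map (f := fun ρ : SectionSpace f a b =>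
          (⟨ρ.1 ⟨P.s i, P.mem_Icc i⟩, ρ.2 _⟩ : Fiber f P i))
        (Continuous.subtype_mk
          ((continuous_eval_const _).comp continuous_subtype_val) _)⟩
    apply Subtype.ext
    funext c
    cases c with
    | pt i => exact ZerothHomotopy.sound (key i).somePath
    | seg i =>
      exact ZerothHomotopy.sound ((key i.castSucc).somePath.map (inclLeft f P i).continuous))

end Sections

end

/-!
The space `Γf` of sections maps to the homotopy limit of `ZX`, whose points are the sequential
paths, and the exact sequence describes the path components of such a homotopy limit.  So two
things have to be shown: every sequential path is realized by a section (`exists_realizes`), and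
two sections are joined by a path of sections as soon as their values at the points of the
partition are joined by paths which are compatible, up to homotopy, with the paths they give in
the slabs `Xᵢⁱ⁺¹` (`joined_of_naturality`).  What remains is algebra in the fundamental groupoids
of the fibres and slabs (`mk_difference_eq_iff`, `exists_difference_eq`, `exists_classification`)
and the computation of `R¹lim` over a zigzag (`derivedLimEquiv`).

Both facts are proved by extending sections, and paths of sections, from one slab to the next.
This needs a weak form of a gradient-like flow: a motion of the points of a slab which lifts the
motion upwards or downwards of the real line (`HasLift`).

* If the points of a slab can be moved upwards, then the slab retracts onto its upper fibre, and
  its sections are determined up to homotopy by their first value.  So sections extend over the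
  slab, and the class of the path at the upper fibre is determined by faithfulness of the functor
  induced by the inclusion.
* If they can be moved downwards, the slab retracts onto its lower fibre, and its sections are
  determined up to homotopy by their last value.  The section below must then be deformed so that
  its end follows a prescribed path or homotopy.  This is possible since one can move downwards
  just below the slab as well (`IsFlexible`, `exists_flex`).

A slab with at most one critical point of `f` on the side `B` has one of these two properties
(`IsTame.isLiftable`).  Near a point, move along a straight line in a chart, in a direction in
which the derivative is positive, and which does not point out of the quadrant
(`hasUpLiftOn_of_line`).  At a point of `B` off the two ends only one coordinate of the chart is a
boundary coordinate.  At a regular point of `B` there is such a direction tangent to `B`, for `f`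
and for `-f`.  At a critical point the derivative is a multiple of the boundary coordinate, so its
sign decides which of `f` and `-f` has such a direction.  On the two ends the derivative is a
multiple of the boundary coordinate of the end, which is where the motion stops.  By compactness,
the local motions combine to a motion of uniform height (`exists_hasUpLiftOn`), which can be
iterated.  The motions are only continuous, and no differential equation has to be solved.
-/

/-! ### Lifting motions of the line -/

section Lift

variable {X : Type u} [TopologicalSpace X] {f : X → ℝ} {D D' : Set (ℝ × ℝ)} {a b c : ℝ}

/-- A continuous choice, for all `x` and `t` with `(f x, t) ∈ D`, of a point `φ x t` over `t`, which
is `x` itself when `t = f x`. -/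
def HasLift (f : X → ℝ) (D : Set (ℝ × ℝ)) : Prop :=
  ∃ φ : X → ℝ → X, ContinuousOn (Function.uncurry φ) {z | (f z.1, z.2) ∈ D} ∧
    (∀ x t, (f x, t) ∈ D → f (φ x t) = t) ∧ ∀ x, (f x, f x) ∈ D → φ x (f x) = x

/-- The motions upwards inside `[a, b]`. -/
def upMoves (a b : ℝ) : Set (ℝ × ℝ) := {z | a ≤ z.1 ∧ z.1 ≤ z.2 ∧ z.2 ≤ b}

/-- The motions downwards inside `[a, b]`. -/
def downMoves (a b : ℝ) : Set (ℝ × ℝ) := {z | a ≤ z.2 ∧ z.2 ≤ z.1 ∧ z.1 ≤ b}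

theorem isClosed_upMoves (a b : ℝ) : IsClosed (upMoves a b) :=
  (isClosed_le continuous_const continuous_fst).inter
    ((isClosed_le continuous_fst continuous_snd).inter
      (isClosed_le continuous_snd continuous_const))

theorem isClosed_downMoves (a b : ℝ) : IsClosed (downMoves a b) :=
  (isClosed_le continuous_const continuous_snd).inter
    ((isClosed_le continuous_snd continuous_fst).inter
      (isClosed_le continuous_fst continuous_const))

theorem HasLift.mono (h : HasLift f D) (hD : D' ⊆ D) : HasLift f D' := by
  obtain ⟨φ, hc, h1, h2⟩ := h
  exact ⟨φ, hc.mono fun z hz => hD hz, fun x t ht => h1 x t (hD ht), fun x hx => h2 x (hD hx)⟩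

/-- On the diagonal of `ℝ × ℝ` there is no motion, so it may be added to the domain. -/
theorem HasLift.union_diagonal (hf : Continuous f) (hD : IsClosed D) (h : HasLift f D) :
    HasLift f (D ∪ diagonal ℝ) := by
  classical
  obtain ⟨φ, hc, h1, h2⟩ := h
  have key : ∀ x t, f x = t → (if (f x, t) ∈ D then φ x t else x) = x := by
    rintro x _ rfl
    split_ifs with h
    · exact h2 x h
    · rfl
  refine ⟨fun x t => if (f x, t) ∈ D then φ x t else x, ?_, ?_, ?_⟩
  · have hS : {z : X × ℝ | (f z.1, z.2) ∈ D ∪ diagonal ℝ} =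
        {z : X × ℝ | (f z.1, z.2) ∈ D} ∪ {z : X × ℝ | f z.1 = z.2} := rfl
    rw [hS]
    refine ContinuousOn.union_of_isClosed (hc.congr ?_) (continuous_fst.continuousOn.congr ?_)
      (hD.preimage (by fun_prop)) (isClosed_eq (by fun_prop) (by fun_prop))
    · rintro ⟨x, t⟩ hz
      exact if_pos hz
    · rintro ⟨x, t⟩ hz
      exact key x t hz
  · rintro x t (h | h)
    · simp only [h, if_true]
      exact h1 x t h
    · exact (congrArg f (key x t h)).trans h
  · exact fun x _ => key x _ rfl

theorem HasLift.neg (h : HasLift f D) : HasLift (fun x => -f x) {z | (-z.1, -z.2) ∈ D} := by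
  obtain ⟨φ, hc, h1, h2⟩ := h
  refine ⟨fun x t => φ x (-t), ?_, ?_, ?_⟩
  · refine hc.comp (f := fun z : X × ℝ => (z.1, -z.2)) (by fun_prop) ?_
    rintro ⟨x, t⟩ hz
    simpa using hz
  · intro x t ht
    simp only [mem_ofPred_eq, neg_neg] at ht
    simp [h1 x (-t) ht]
  · intro x hx
    simp only [mem_ofPred_eq, neg_neg] at hx
    simp [h2 x hx]

theorem HasLift.upMoves_trans (hf : Continuous f) (h : HasLift f (upMoves a b))
    (h' : HasLift f (upMoves b c)) : HasLift f (upMoves a c) := by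
  obtain ⟨φ, hc, h1, h2⟩ := h.union_diagonal hf (isClosed_upMoves a b)
  obtain ⟨ψ, hc', h1', h2'⟩ := h'.union_diagonal hf (isClosed_upMoves b c)
  -- move up to the level `b` if it lies on the way, and from there to `t`
  have e1 : ∀ x t, (f x, t) ∈ upMoves a c →
      (f x, min t (max b (f x))) ∈ upMoves a b ∪ diagonal ℝ := by
    rintro x t ⟨h1, h2, h3⟩
    dsimp only at h1 h2 h3
    rcases le_total b (f x) with h | h
    · right
      simp [h, h2]
    · left
      exact ⟨h1, by simp [h, h2], by simp [h]⟩
  have e2 : ∀ x t, (f x, t) ∈ upMoves a c →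
      (f (φ x (min t (max b (f x)))), t) ∈ upMoves b c ∪ diagonal ℝ := by
    intro x t ht
    rw [h1 _ _ (e1 x t ht)]
    obtain ⟨h1, h2, h3⟩ := ht
    dsimp only at h1 h2 h3
    rcases le_total b t with h | h
    · left
      exact ⟨by simp [h], by simp, h3⟩
    · right
      simp [h]
  refine ⟨fun x t => ψ (φ x (min t (max b (f x)))) t, ?_, fun x t ht => h1' _ _ (e2 x t ht), ?_⟩
  · refine hc'.comp (f := fun z : X × ℝ => (φ z.1 (min z.2 (max b (f z.1))), z.2)) ?_
      (fun z hz => e2 z.1 z.2 hz)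
    refine ContinuousOn.prodMk ?_ continuousOn_snd
    exact hc.comp (f := fun z : X × ℝ => (z.1, min z.2 (max b (f z.1))))
      (by fun_prop) (fun z hz => e1 z.1 z.2 hz)
  · intro x hx
    have h3 : φ x (min (f x) (max b (f x))) = x := by
      rw [min_eq_left (le_max_right _ _)]
      exact h2 x (Or.inr rfl)
    dsimp only
    rw [h3]
    exact h2' x (Or.inr rfl)

/-- One can move downwards just below `b`: the level `t ∈ [a, b]` can be reached from the levels up
to `v t`, where `v b > b`.  Thus the last part of a section over `[a, b]` can be replaced by motions
downwards from points over `b`.  The value `v b = b + 1` leaves one unit of time to move these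
points inside the fibre over `b`.  Where `v t = t` nothing is claimed. -/
def IsFlexible (f : X → ℝ) (a b : ℝ) : Prop :=
  ∃ v : ℝ → ℝ, Continuous v ∧ (∀ t, t ≤ v t) ∧ v b = b + 1 ∧
    HasLift f {z | z.2 ∈ Icc a b ∧ z.2 ≤ z.1 ∧ z.1 ≤ min (v z.2) b}

theorem isFlexible_self (f : X → ℝ) (a : ℝ) : IsFlexible f a a := by
  refine ⟨fun t => t + 1, by fun_prop, fun t => by simp, rfl, fun x _ => x,
    continuousOn_fst, ?_, fun _ _ => rfl⟩
  rintro x t ⟨⟨h1, h2⟩, h3, h4⟩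
  have := h4.trans (min_le_right _ _)
  dsimp only at *
  linarith

/-- It suffices to be able to move downwards in a slab below `b`, which may be small compared with
`[c, b]`. -/
theorem isFlexible_of_hasLift (hf : Continuous f) (hab : a < b) (h : HasLift f (downMoves a b))
    (c : ℝ) : IsFlexible f c b := by
  have hba : 0 < b - a := sub_pos.2 hab
  refine ⟨fun t => t + max 0 ((t - a) / (b - a)), by fun_prop, fun t => by simp, ?_, ?_⟩
  · dsimp only
    rw [div_self hba.ne']
    simp
  refine (h.union_diagonal hf (isClosed_downMoves a b)).mono ?_
  rintro ⟨u, t⟩ ⟨⟨h1, h2⟩, h3, h4⟩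
  dsimp only at *
  rcases le_total a t with hat | hat
  · left
    exact ⟨hat, h3, h4.trans (min_le_right _ _)⟩
  · right
    have : (t - a) / (b - a) ≤ 0 := div_nonpos_of_nonpos_of_nonneg (by linarith) hba.le
    rw [max_eq_left this, add_zero] at h4
    exact le_antisymm (h4.trans (min_le_left _ _)) h3

end Lift

/-! ### Operations on spaces of sections -/

namespace SectionSpace

variable {X : Type u} [TopologicalSpace X] {f : X → ℝ} {a b c a' b' t : ℝ}

/-- Restriction of sections to a smaller interval. -/
def res (f : X → ℝ) (h : Icc a' b' ⊆ Icc a b) : C(SectionSpace f a b, SectionSpace f a' b') where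
  toFun σ := ⟨σ.1.comp ⟨inclusion h, continuous_inclusion h⟩, fun t => σ.2 (inclusion h t)⟩
  continuous_toFun :=
    ((ContinuousMap.continuous_precomp _).comp continuous_subtype_val).subtype_mk _

/-- Evaluation of sections, with values in a fibre. -/
def evalAt (f : X → ℝ) (ht : t ∈ Icc a b) : C(SectionSpace f a b, {p : X // f p = t}) where
  toFun σ := ⟨σ.1 ⟨t, ht⟩, σ.2 ⟨t, ht⟩⟩
  continuous_toFun :=
    ((continuous_eval_const _).comp continuous_subtype_val).subtype_mk _

/-- The value at a real number, which is first moved to the nearest point of the interval. -/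
noncomputable def value (h : a ≤ b) (σ : SectionSpace f a b) (t : ℝ) : X := σ.1 (projIcc a b h t)

theorem value_of_mem (h : a ≤ b) (σ : SectionSpace f a b) (ht : t ∈ Icc a b) :
    value h σ t = σ.1 ⟨t, ht⟩ := by
  rw [value, projIcc_of_mem h ht]

theorem apply_value (h : a ≤ b) (σ : SectionSpace f a b) (ht : t ∈ Icc a b) :
    f (value h σ t) = t := by
  rw [value_of_mem h σ ht, σ.2]

theorem continuous_value (h : a ≤ b) :
    Continuous (fun z : SectionSpace f a b × ℝ => value h z.1 z.2) := by
  unfold value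
  have : Continuous (fun z : SectionSpace f a b × ℝ => projIcc a b h z.2) :=
    continuous_projIcc.comp continuous_snd
  fun_prop

/-- A family of sections depending continuously on a parameter. -/
def family {Y : Type*} [TopologicalSpace Y] (F : Y × Icc a b → X) (hF : Continuous F)
    (hf : ∀ y t, f (F (y, t)) = t) : C(Y, SectionSpace f a b) where
  toFun y := ⟨⟨fun t => F (y, t), by fun_prop⟩, hf y⟩
  continuous_toFun := (ContinuousMap.curry ⟨F, hF⟩).continuous.subtype_mk _

theorem ext_of_res (hab : a ≤ b) (hbc : b ≤ c) {σ τ : SectionSpace f a c}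
    (h : res f (Icc_subset_Icc_right hbc) σ = res f (Icc_subset_Icc_right hbc) τ)
    (h' : res f (Icc_subset_Icc_left hab) σ = res f (Icc_subset_Icc_left hab) τ) : σ = τ := by
  apply Subtype.ext
  ext t
  rcases le_total (t : ℝ) b with ht | ht
  · exact congrArg (fun ρ : SectionSpace f a b => ρ.1 ⟨t, t.2.1, ht⟩) h
  · exact congrArg (fun ρ : SectionSpace f b c => ρ.1 ⟨t, ht, t.2.2⟩) h'

/-- Families of sections over adjacent intervals which agree at the common point can be glued. -/
theorem exists_glue {Y : Type*} [TopologicalSpace Y] (hab : a ≤ b) (hbc : b ≤ c)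
    (h : C(Y, SectionSpace f a b)) (k : C(Y, SectionSpace f b c))
    (hk : ∀ y, evalAt f (right_mem_Icc.2 hab) (h y) = evalAt f (left_mem_Icc.2 hbc) (k y)) :
    ∃ g : C(Y, SectionSpace f a c), ∀ y, res f (Icc_subset_Icc_right hbc) (g y) = h y ∧
      res f (Icc_subset_Icc_left hab) (g y) = k y := by
  let F : Y × Icc a c → X := fun z =>
    if (z.2 : ℝ) ≤ b then value hab (h z.1) z.2 else value hbc (k z.1) z.2
  have hF : Continuous F := by
    refine Continuous.if_le
      ((continuous_value hab).comp (f := fun z : Y × Icc a c => (h z.1, (z.2 : ℝ))) (by fun_prop))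
      ((continuous_value hbc).comp (f := fun z : Y × Icc a c => (k z.1, (z.2 : ℝ))) (by fun_prop))
      (by fun_prop) continuous_const ?_
    rintro ⟨y, t⟩ ht
    dsimp only at ht ⊢
    rw [ht, value_of_mem hab _ (right_mem_Icc.2 hab), value_of_mem hbc _ (left_mem_Icc.2 hbc)]
    exact congrArg Subtype.val (hk y)
  have hFf : ∀ y t, f (F (y, t)) = t := by
    intro y t
    dsimp only [F]
    split_ifs with ht
    · exact apply_value hab _ ⟨t.2.1, ht⟩
    · exact apply_value hbc _ ⟨(not_le.1 ht).le, t.2.2⟩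
  refine ⟨family F hF hFf, fun y => ⟨?_, ?_⟩⟩
  · apply Subtype.ext
    ext t
    change F (y, ⟨t, _⟩) = _
    dsimp only [F]
    rw [if_pos t.2.2, value_of_mem hab _ t.2]
  · apply Subtype.ext
    ext t
    change F (y, ⟨t, _⟩) = _
    dsimp only [F]
    split_ifs with ht
    · have ht' : (t : ℝ) = b := le_antisymm ht t.2.1
      have : t = ⟨b, left_mem_Icc.2 hbc⟩ := Subtype.ext ht'
      subst this
      rw [value_of_mem hab _ (right_mem_Icc.2 hab)]
      exact congrArg Subtype.val (hk y)
    · rw [value_of_mem hbc _ t.2]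

/-- Paths of sections over adjacent intervals which agree at the common point can be glued. -/
theorem exists_glue_path (hab : a ≤ b) (hbc : b ≤ c) {σ τ : SectionSpace f a c}
    (H : Path (res f (Icc_subset_Icc_right hbc) σ) (res f (Icc_subset_Icc_right hbc) τ))
    (K : Path (res f (Icc_subset_Icc_left hab) σ) (res f (Icc_subset_Icc_left hab) τ))
    (hk : ∀ s, evalAt f (right_mem_Icc.2 hab) (H s) = evalAt f (left_mem_Icc.2 hbc) (K s)) :
    ∃ L : Path σ τ, ∀ s, res f (Icc_subset_Icc_right hbc) (L s) = H s ∧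
      res f (Icc_subset_Icc_left hab) (L s) = K s := by
  obtain ⟨g, hg⟩ := exists_glue hab hbc H.toContinuousMap K.toContinuousMap hk
  refine ⟨⟨g, ?_, ?_⟩, hg⟩
  · refine ext_of_res hab hbc ((hg 0).1.trans ?_) ((hg 0).2.trans ?_)
    · exact H.source
    · exact K.source
  · refine ext_of_res hab hbc ((hg 1).1.trans ?_) ((hg 1).2.trans ?_)
    · exact H.target
    · exact K.target

/-- Moving upwards from the lowest point gives a section through each point of the lowest fibre, and
any section can be deformed to one of these, keeping its first value. -/
theorem exists_contraction_of_up (hab : a ≤ b) (h : HasLift f (upMoves a b)) :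
    ∃ Θ : C({p : X // f p = a}, SectionSpace f a b),
      (∀ p, evalAt f (left_mem_Icc.2 hab) (Θ p) = p) ∧
      ∀ σ, ∃ H : Path (Θ (evalAt f (left_mem_Icc.2 hab) σ)) σ,
        ∀ s, evalAt f (left_mem_Icc.2 hab) (H s) = evalAt f (left_mem_Icc.2 hab) σ := by
  obtain ⟨φ, hc, h1, h2⟩ := h
  have hΘ : ∀ (p : {p : X // f p = a}) (t : Icc a b), (f p.1, (t : ℝ)) ∈ upMoves a b :=
    fun p t => ⟨p.2.ge, p.2.trans_le t.2.1, t.2.2⟩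
  refine ⟨family (fun z => φ z.1.1 z.2)
    (hc.comp_continuous (f := fun z : {p : X // f p = a} × Icc a b => (z.1.1, (z.2 : ℝ)))
      (by fun_prop) fun z => hΘ z.1 z.2) fun p t => h1 _ _ (hΘ p t), ?_, ?_⟩
  · rintro ⟨p, rfl⟩
    exact Subtype.ext (h2 p (hΘ ⟨p, rfl⟩ ⟨f p, left_mem_Icc.2 hab⟩))
  intro σ
  -- at time `s`, follow `σ` up to the level `(1 - s) * a + s * b` and move upwards from there
  let m : unitInterval → ℝ := fun s => (1 - (s : ℝ)) * a + s * b
  have hm : ∀ s, m s ∈ Icc a b := fun s => by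
    have h0 := s.2.1
    have h1 := s.2.2
    constructor <;> dsimp only [m] <;> nlinarith
  have hmem : ∀ (s : unitInterval) (t : Icc a b), min (t : ℝ) (m s) ∈ Icc a b :=
    fun s t => ⟨le_min t.2.1 (hm s).1, (min_le_left _ _).trans t.2.2⟩
  have hD : ∀ (s : unitInterval) (t : Icc a b),
      (f (value hab σ (min (t : ℝ) (m s))), (t : ℝ)) ∈ upMoves a b := fun s t => by
    rw [apply_value hab σ (hmem s t)]
    exact ⟨(hmem s t).1, min_le_left _ _, t.2.2⟩
  have hmc : Continuous m := by fun_prop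
  let G := family (f := f) (fun z : unitInterval × Icc a b =>
      φ (value hab σ (min (z.2 : ℝ) (m z.1))) z.2)
    (hc.comp_continuous
      (f := fun z : unitInterval × Icc a b => (value hab σ (min (z.2 : ℝ) (m z.1)), (z.2 : ℝ)))
      (((continuous_value hab).comp
        (f := fun z : unitInterval × Icc a b => (σ, min (z.2 : ℝ) (m z.1))) (by fun_prop)).prodMk
        (by fun_prop)) fun z => hD z.1 z.2) fun s t => h1 _ _ (hD s t)
  refine ⟨⟨G, ?_, ?_⟩, fun s => ?_⟩
  · apply Subtype.ext
    ext t
    change φ (value hab σ (min (t : ℝ) (m 0))) t = φ (σ.1 ⟨a, _⟩) t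
    rw [show m 0 = a by simp [m], min_eq_right t.2.1, value_of_mem hab _ (left_mem_Icc.2 hab)]
  · apply Subtype.ext
    ext t
    change φ (value hab σ (min (t : ℝ) (m 1))) t = σ.1 t
    have := hD 1 t
    rw [show m 1 = b by simp [m], min_eq_left t.2.2, value_of_mem hab _ t.2] at this ⊢
    have h3 := h2 (σ.1 t)
    rw [σ.2] at this h3
    exact h3 this
  · apply Subtype.ext
    change φ (value hab σ (min a (m s))) a = σ.1 ⟨a, _⟩
    have := hD s ⟨a, left_mem_Icc.2 hab⟩
    dsimp only at this
    rw [min_eq_left (hm s).1, value_of_mem hab _ (left_mem_Icc.2 hab)] at this ⊢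
    have h3 := h2 (σ.1 ⟨a, left_mem_Icc.2 hab⟩)
    rw [σ.2] at this h3
    exact h3 this

/-- Moving downwards from the highest point gives a section through each point of the highest fibre,
and any section can be deformed to one of these, keeping its last value. -/
theorem exists_contraction_of_down (hab : a ≤ b) (h : HasLift f (downMoves a b)) :
    ∃ Θ : C({p : X // f p = b}, SectionSpace f a b),
      (∀ p, evalAt f (right_mem_Icc.2 hab) (Θ p) = p) ∧
      ∀ σ, ∃ H : Path (Θ (evalAt f (right_mem_Icc.2 hab) σ)) σ,
        ∀ s, evalAt f (right_mem_Icc.2 hab) (H s) = evalAt f (right_mem_Icc.2 hab) σ := by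
  obtain ⟨φ, hc, h1, h2⟩ := h
  have hΘ : ∀ (p : {p : X // f p = b}) (t : Icc a b), (f p.1, (t : ℝ)) ∈ downMoves a b :=
    fun p t => ⟨t.2.1, t.2.2.trans_eq p.2.symm, p.2.le⟩
  refine ⟨family (fun z => φ z.1.1 z.2)
    (hc.comp_continuous (f := fun z : {p : X // f p = b} × Icc a b => (z.1.1, (z.2 : ℝ)))
      (by fun_prop) fun z => hΘ z.1 z.2) fun p t => h1 _ _ (hΘ p t), ?_, ?_⟩
  · rintro ⟨p, rfl⟩
    exact Subtype.ext (h2 p (hΘ ⟨p, rfl⟩ ⟨f p, right_mem_Icc.2 hab⟩))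
  intro σ
  -- at time `s`, follow `σ` down to the level `(1 - s) * b + s * a` and move downwards from there
  let m : unitInterval → ℝ := fun s => (1 - (s : ℝ)) * b + s * a
  have hm : ∀ s, m s ∈ Icc a b := fun s => by
    have h0 := s.2.1
    have h1 := s.2.2
    constructor <;> dsimp only [m] <;> nlinarith
  have hmem : ∀ (s : unitInterval) (t : Icc a b), max (t : ℝ) (m s) ∈ Icc a b :=
    fun s t => ⟨t.2.1.trans (le_max_left _ _), max_le t.2.2 (hm s).2⟩
  have hD : ∀ (s : unitInterval) (t : Icc a b),
      (f (value hab σ (max (t : ℝ) (m s))), (t : ℝ)) ∈ downMoves a b := fun s t => by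
    rw [apply_value hab σ (hmem s t)]
    exact ⟨t.2.1, le_max_left _ _, (hmem s t).2⟩
  have hmc : Continuous m := by fun_prop
  let G := family (f := f) (fun z : unitInterval × Icc a b =>
      φ (value hab σ (max (z.2 : ℝ) (m z.1))) z.2)
    (hc.comp_continuous
      (f := fun z : unitInterval × Icc a b => (value hab σ (max (z.2 : ℝ) (m z.1)), (z.2 : ℝ)))
      (((continuous_value hab).comp
        (f := fun z : unitInterval × Icc a b => (σ, max (z.2 : ℝ) (m z.1))) (by fun_prop)).prodMk
        (by fun_prop)) fun z => hD z.1 z.2) fun s t => h1 _ _ (hD s t)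
  refine ⟨⟨G, ?_, ?_⟩, fun s => ?_⟩
  · apply Subtype.ext
    ext t
    change φ (value hab σ (max (t : ℝ) (m 0))) t = φ (σ.1 ⟨b, _⟩) t
    rw [show m 0 = b by simp [m], max_eq_right t.2.2, value_of_mem hab _ (right_mem_Icc.2 hab)]
  · apply Subtype.ext
    ext t
    change φ (value hab σ (max (t : ℝ) (m 1))) t = σ.1 t
    have := hD 1 t
    rw [show m 1 = a by simp [m], max_eq_left t.2.1, value_of_mem hab _ t.2] at this ⊢
    have h3 := h2 (σ.1 t)
    rw [σ.2] at this h3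
    exact h3 this
  · apply Subtype.ext
    change φ (value hab σ (max b (m s))) b = σ.1 ⟨b, _⟩
    have := hD s ⟨b, right_mem_Icc.2 hab⟩
    dsimp only at this
    rw [max_eq_left (hm s).2, value_of_mem hab _ (right_mem_Icc.2 hab)] at this ⊢
    have h3 := h2 (σ.1 ⟨b, right_mem_Icc.2 hab⟩)
    rw [σ.2] at this h3
    exact h3 this

/-- If one can move downwards near the top level, the ends of a family `h` of sections can be moved
along paths `W s` in the highest fibre, for a time `lam s`. -/
theorem exists_flex (hab : a ≤ b) (hfl : IsFlexible f a b)
    (h : C(unitInterval, SectionSpace f a b))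
    (W : C(unitInterval × unitInterval, {p : X // f p = b}))
    (hW : ∀ s, W (s, 0) = evalAt f (right_mem_Icc.2 hab) (h s))
    (lam : C(unitInterval, unitInterval)) :
    ∃ g : C(unitInterval, SectionSpace f a b), (∀ s, lam s = 0 → g s = h s) ∧
      ∀ s, evalAt f (right_mem_Icc.2 hab) (g s) = W (s, lam s) := by
  obtain ⟨v, hv, hv1, hvb, φ, hc, h1, h2⟩ := hfl
  -- `V s u` runs through `h s` until the level `b` and then along `W s` for one unit of time
  let V : unitInterval × ℝ → X := fun z =>
    if z.2 ≤ b then value hab (h z.1) z.2 else (W (z.1, projIcc 0 1 zero_le_one (z.2 - b))).1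
  have hV : Continuous V := by
    refine Continuous.if_le
      ((continuous_value hab).comp (f := fun z : unitInterval × ℝ => (h z.1, z.2)) (by fun_prop))
      ?_ (by fun_prop) continuous_const ?_
    · have : Continuous fun z : unitInterval × ℝ =>
        projIcc (0 : ℝ) 1 zero_le_one (z.2 - b) := continuous_projIcc.comp (by fun_prop)
      exact continuous_subtype_val.comp (W.continuous.comp (continuous_fst.prodMk this))
    · rintro ⟨s, t⟩ ht
      dsimp only at ht ⊢
      subst ht
      rw [value_of_mem hab _ (right_mem_Icc.2 hab), sub_self, projIcc_left]
      exact congrArg Subtype.val (hW s).symm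
  have hfV : ∀ s u, a ≤ u → f (V (s, u)) = min u b := by
    intro s u hu
    dsimp only [V]
    split_ifs with hub
    · rw [apply_value hab (h s) ⟨hu, hub⟩, min_eq_left hub]
    · rw [min_eq_right (not_le.1 hub).le]
      exact (W _).2
  -- the value at `t` is reached from `V s (r s t)`, with `r s t = t` if `lam s = 0`
  let r : unitInterval → ℝ → ℝ := fun s t => (1 - (lam s : ℝ)) * t + lam s * v t
  have hr1 : ∀ s t, t ≤ r s t := fun s t => by
    have h0 := (lam s).2.1
    have h3 := hv1 t
    dsimp only [r]
    nlinarith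
  have hr2 : ∀ s t, r s t ≤ v t := fun s t => by
    have h0 := (lam s).2.2
    have h3 := hv1 t
    dsimp only [r]
    nlinarith
  have hD : ∀ (s : unitInterval) (t : Icc a b), (f (V (s, r s t)), (t : ℝ)) ∈
      {z : ℝ × ℝ | z.2 ∈ Icc a b ∧ z.2 ≤ z.1 ∧ z.1 ≤ min (v z.2) b} := by
    intro s t
    rw [hfV s _ (t.2.1.trans (hr1 s t))]
    exact ⟨t.2, le_min (hr1 s t) t.2.2, min_le_min_right _ (hr2 s t)⟩
  refine ⟨family (fun z => φ (V (z.1, r z.1 z.2)) z.2)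
    (hc.comp_continuous
      (f := fun z : unitInterval × Icc a b => (V (z.1, r z.1 z.2), (z.2 : ℝ)))
      ((hV.comp (continuous_fst.prodMk (by fun_prop))).prodMk (by fun_prop))
      fun z => hD z.1 z.2) fun s t => h1 _ _ (hD s t), fun s hs => ?_, fun s => ?_⟩
  · apply Subtype.ext
    ext t
    change φ (V (s, r s t)) t = (h s).1 t
    have h3 : V (s, r s t) = (h s).1 t := by
      have : r s t = t := by simp [r, hs]
      rw [this]
      dsimp only [V]
      rw [if_pos t.2.2, value_of_mem hab _ t.2]
    have h4 := hD s t
    have h5 := h2 ((h s).1 t)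
    rw [h3] at h4 ⊢
    rw [(h s).2] at h4 h5
    exact h5 h4
  · apply Subtype.ext
    change φ (V (s, r s b)) b = (W (s, lam s)).1
    have h3 : V (s, r s b) = (W (s, lam s)).1 := by
      have : r s b = b + lam s := by
        dsimp only [r]
        rw [hvb]
        ring
      rw [this]
      dsimp only [V]
      split_ifs with hl
      · have : lam s = 0 := Subtype.ext (le_antisymm (by simpa using hl) (lam s).2.1)
        rw [this]
        simp only [Icc.coe_zero, add_zero]
        rw [value_of_mem hab _ (right_mem_Icc.2 hab), hW]
        rfl
      · rw [add_sub_cancel_left, projIcc_val]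
    have h4 := hD s ⟨b, right_mem_Icc.2 hab⟩
    have h5 := h2 (W (s, lam s)).1
    dsimp only at h4
    rw [h3] at h4 ⊢
    rw [(W (s, lam s)).2] at h4 h5
    exact h5 h4

/-- A section can be deformed so that its last value moves along a given path. -/
theorem exists_path_of_flexible (hab : a ≤ b) (hfl : IsFlexible f a b) (σ : SectionSpace f a b)
    {z : {p : X // f p = b}} (w : Path (evalAt f (right_mem_Icc.2 hab) σ) z) :
    ∃ (τ : SectionSpace f a b) (H : Path σ τ),
      ∀ s, evalAt f (right_mem_Icc.2 hab) (H s) = w s := by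
  obtain ⟨g, hg, hg'⟩ := exists_flex hab hfl (ContinuousMap.const _ σ)
    (w.toContinuousMap.comp ContinuousMap.snd) (fun s => w.source) (ContinuousMap.id _)
  exact ⟨g 1, ⟨g, hg 0 rfl, rfl⟩, hg'⟩

/-- A reparametrization of the unit interval which is constant near both ends. -/
noncomputable def pause (s : unitInterval) : unitInterval :=
  projIcc 0 1 zero_le_one (3 * (s : ℝ) - 1)

theorem continuous_pause : Continuous pause := continuous_projIcc.comp (by fun_prop)

theorem pause_zero : pause 0 = 0 := projIcc_of_le_left _ (by simp)

theorem pause_one : pause 1 = 1 := projIcc_of_right_le _ (by norm_num)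

/-- A path of sections can be deformed so that its last values run along any path homotopic to the
original one, up to a reparametrization. -/
theorem exists_path_of_flexible_of_homotopic (hab : a ≤ b) (hfl : IsFlexible f a b)
    {σ τ : SectionSpace f a b} (H : Path σ τ)
    (w : Path (evalAt f (right_mem_Icc.2 hab) σ) (evalAt f (right_mem_Icc.2 hab) τ))
    (hw : (H.map (evalAt f (right_mem_Icc.2 hab)).continuous).Homotopic w) :
    ∃ H' : Path σ τ, ∀ s, evalAt f (right_mem_Icc.2 hab) (H' s) = w (pause s) := by
  obtain ⟨F⟩ := hw
  -- the first and last third of the time serve to prepare the two ends for the homotopy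
  let lam : C(unitInterval, unitInterval) :=
    ⟨fun s => projIcc 0 1 zero_le_one (min (3 * (s : ℝ)) (3 - 3 * s)),
      continuous_projIcc.comp (by fun_prop)⟩
  have hp := continuous_pause
  obtain ⟨g, hg, hg'⟩ := exists_flex hab hfl (H.toContinuousMap.comp ⟨pause, hp⟩)
    ⟨fun z : unitInterval × unitInterval => F (z.2, pause z.1), by fun_prop⟩
    (fun s => F.apply_zero (pause s)) lam
  refine ⟨⟨g, (hg 0 ?_).trans ?_, (hg 1 ?_).trans ?_⟩, fun s => (hg' s).trans ?_⟩
  · exact projIcc_of_le_left zero_le_one (by simp)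
  · change H (pause 0) = σ
    rw [pause_zero, H.source]
  · exact projIcc_of_le_left zero_le_one (by simp)
  · change H (pause 1) = τ
    rw [pause_one, H.target]
  · change F (lam s, pause s) = w (pause s)
    rcases le_total (s : ℝ) (1 / 3) with h | h
    · rw [show pause s = 0 from projIcc_of_le_left zero_le_one (by linarith), w.source]
      exact (F.source _).trans rfl
    rcases le_total (2 / 3) (s : ℝ) with h' | h'
    · rw [show pause s = 1 from projIcc_of_right_le zero_le_one (by linarith), w.target]
      exact (F.target _).trans rfl
    · rw [show lam s = 1 from projIcc_of_right_le zero_le_one (le_min (by linarith) (by linarith))]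
      exact F.apply_one _

end SectionSpace

/-! ### Fibres, slabs and their fundamental groupoids -/

/-- The class of a path in the fundamental groupoid. -/
abbrev pathClass {Z : Type*} [TopologicalSpace Z] {x y : Z} (p : Path x y) :
    FundamentalGroupoid.mk x ⟶ FundamentalGroupoid.mk y :=
  FundamentalGroupoid.fromPath (Path.Homotopic.Quotient.mk p)

section PathClass

variable {Z Z' : Type*} [TopologicalSpace Z] [TopologicalSpace Z']

theorem exists_pathClass_eq {x y : Z}
    (α : FundamentalGroupoid.mk x ⟶ FundamentalGroupoid.mk y) : ∃ p : Path x y, pathClass p = α :=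
  Path.Homotopic.Quotient.mk_surjective α

theorem pathClass_eq_iff {x y : Z} {p q : Path x y} : pathClass p = pathClass q ↔ p.Homotopic q :=
  FundamentalGroupoid.fromPath_eq_iff_homotopic p q

theorem pathClass_trans {x y z : Z} (p : Path x y) (q : Path y z) :
    pathClass (p.trans q) = pathClass p ≫ pathClass q := rfl

theorem pathClass_symm {x y : Z} (p : Path x y) :
    pathClass p.symm = Groupoid.inv (pathClass p) := rfl

theorem map_pathClass (g : C(Z, Z')) {x y : Z} (p : Path x y) :
    (FundamentalGroupoid.map g).map (pathClass p) = pathClass (p.map g.continuous) := rfl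

/-- The boundary of a square commutes up to homotopy. -/
theorem pathClass_square (G : C(unitInterval × unitInterval, Z)) {x y x' y' : Z}
    (l : Path x y) (q : Path y y') (p : Path x x') (r : Path x' y')
    (hl : ∀ s, G (s, 0) = l s) (hq : ∀ t, G (1, t) = q t)
    (hp : ∀ t, G (0, t) = p t) (hr : ∀ s, G (s, 1) = r s) :
    pathClass l ≫ pathClass q = pathClass p ≫ pathClass r := by
  let g₀ : C(unitInterval, Z) := G.comp ⟨fun t => (0, t), by fun_prop⟩
  let g₁ : C(unitInterval, Z) := G.comp ⟨fun t => (1, t), by fun_prop⟩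
  let F : g₀.Homotopy g₁ := ⟨G, fun _ => rfl, fun _ => rfl⟩
  have hx : x = G (0, 0) := by rw [hl, l.source]
  have hy : y = G (1, 0) := by rw [hl, l.target]
  have hx' : x' = G (0, 1) := by rw [hr, r.source]
  have hy' : y' = G (1, 1) := by rw [hr, r.target]
  subst hx hy hx' hy'
  have el : l = F.evalAt 0 := Path.ext (funext fun s => (hl s).symm)
  have er : r = F.evalAt 1 := Path.ext (funext fun s => (hr s).symm)
  let e : Path (0 : unitInterval) 1 := ⟨.id _, rfl, rfl⟩
  have ep : p = e.map g₀.continuous := Path.ext (funext fun t => (hp t).symm)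
  have eq : q = e.map g₁.continuous := Path.ext (funext fun t => (hq t).symm)
  subst el er ep eq
  exact pathClass_eq_iff.2 (Path.Homotopic.map_trans_evalAt F e).symm

theorem pathClass_map_refl_trans_trans_refl (g : C(Z, Z')) {x y : Z} (p : Path x y) :
    pathClass (((Path.refl x).trans (p.trans (Path.refl y))).map g.continuous) =
      pathClass (p.map g.continuous) := by
  rw [← map_pathClass, ← map_pathClass, pathClass_trans, pathClass_trans]
  congr 1
  change 𝟙 _ ≫ pathClass p ≫ 𝟙 _ = pathClass p
  rw [Category.id_comp, Category.comp_id]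

theorem apply_trans_congr {Y : Type*} (g : Z → Y) (g' : Z' → Y) {x y z : Z} {x' y' z' : Z'}
    (p : Path x y) (q : Path y z) (p' : Path x' y') (q' : Path y' z')
    (hp : ∀ s, g (p s) = g' (p' s)) (hq : ∀ s, g (q s) = g' (q' s)) (s : unitInterval) :
    g (p.trans q s) = g' (p'.trans q' s) := by
  simp only [Path.trans_apply]
  split_ifs
  · exact hp _
  · exact hq _

/-- Conjugation by constant paths does not change the class of a path. -/
theorem homotopic_conj_of_const {x x' y y' : Z} (hx : x = x') (hy : y = y') (l : Path x' x)
    (q : Path x' y') (r : Path y' y) (hl : ∀ s, l s = x) (hr : ∀ s, r s = y) :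
    (l.symm.trans (q.trans r)).Homotopic (q.cast hx hy) := by
  subst hx hy
  have hl' : l = Path.refl x := Path.ext (funext hl)
  have hr' : r = Path.refl y := Path.ext (funext hr)
  subst hl' hr'
  rw [← pathClass_eq_iff, pathClass_trans, pathClass_trans, pathClass_symm]
  change Groupoid.inv (𝟙 _) ≫ pathClass q ≫ 𝟙 _ = pathClass q
  simp

/-- A path below can be lifted along a section `Θ` and corrected by paths which stay over its
ends. -/
theorem pathClass_map_conj_section (g : C(Z, Z')) (Θ : C(Z', Z)) (hΘ : ∀ z, g (Θ z) = z) {x y : Z}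
    (w : Path (g x) (g y)) (C : Path (Θ (g x)) x) (D : Path (Θ (g y)) y)
    (hC : ∀ s, g (C s) = g x) (hD : ∀ s, g (D s) = g y) :
    pathClass ((C.symm.trans ((w.map Θ.continuous).trans D)).map g.continuous) = pathClass w := by
  rw [pathClass_eq_iff]
  have h := homotopic_conj_of_const (hΘ (g x)).symm (hΘ (g y)).symm (C.map g.continuous)
    ((w.map Θ.continuous).map g.continuous) (D.map g.continuous) hC hD
  have hw : ((w.map Θ.continuous).map g.continuous).cast (hΘ (g x)).symm (hΘ (g y)).symm = w :=
    Path.ext (funext fun s => hΘ (w s))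
  rw [hw] at h
  simpa only [Path.map_trans, Path.map_symm] using h

end PathClass

section Slab

variable {X : Type u} [TopologicalSpace X] {f : X → ℝ} {a b a' b' : ℝ} {n : ℕ}
  {P : IntervalPartition a b n} {i : Fin n}

theorem IntervalPartition.castSucc_le_succ (P : IntervalPartition a b n) (i : Fin n) :
    P.s i.castSucc ≤ P.s i.succ :=
  (P.strictMono (Fin.castSucc_lt_succ (i := i))).le

/-- If one can move upwards in a slab, then the slab retracts onto its upper fibre. -/
theorem isEquivalence_map_inclRight (hf : Continuous f)
    (h : HasLift f (upMoves (P.s i.castSucc) (P.s i.succ))) :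
    (FundamentalGroupoid.map (inclRight f P i)).IsEquivalence := by
  obtain ⟨φ, hc, h1, h2⟩ := h
  have hD : ∀ (p : Slab f P i) (t : ℝ), f p ≤ t → t ≤ P.s i.succ →
    (f p.1, t) ∈ upMoves (P.s i.castSucc) (P.s i.succ) := fun p t ht ht' => ⟨p.2.1, ht, ht'⟩
  let r : C(Slab f P i, Fiber f P i.succ) :=
    ⟨fun p => ⟨φ p.1 (P.s i.succ), h1 _ _ (hD p _ p.2.2 le_rfl)⟩,
      (hc.comp_continuous (f := fun p : Slab f P i => (p.1, P.s i.succ)) (by fun_prop)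
        fun p => hD p _ p.2.2 le_rfl).subtype_mk _⟩
  let m : unitInterval × Slab f P i → ℝ := fun z =>
    (1 - (z.1 : ℝ)) * P.s i.succ + z.1 * f z.2
  have hm : ∀ z, f z.2 ≤ m z ∧ m z ≤ P.s i.succ := fun z => by
    have h0 := z.1.2.1
    have h3 := z.1.2.2
    have h4 := z.2.2.2
    constructor <;> dsimp only [m] <;> nlinarith
  have hmD : ∀ z, (f z.2.1, m z) ∈ upMoves (P.s i.castSucc) (P.s i.succ) :=
    fun z => hD z.2 _ (hm z).1 (hm z).2
  have hmc : Continuous m := by fun_prop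
  have hFc : Continuous fun z : unitInterval × Slab f P i => φ z.2.1 (m z) :=
    hc.comp_continuous (f := fun z : unitInterval × Slab f P i => (z.2.1, m z)) (by fun_prop) hmD
  have hFm : ∀ z : unitInterval × Slab f P i, f (φ z.2.1 (m z)) ∈ P.piece i := fun z => by
    rw [h1 _ _ (hmD z)]
    exact ⟨z.2.2.1.trans (hm z).1, (hm z).2⟩
  let F : ((inclRight f P i).comp r).Homotopy (ContinuousMap.id _) :=
    { toFun := fun z => ⟨φ z.2.1 (m z), hFm z⟩
      continuous_toFun := hFc.subtype_mk _
      map_zero_left := fun p => Subtype.ext <| by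
        change φ p.1 (m (0, p)) = φ p.1 (P.s i.succ)
        simp [m]
      map_one_left := fun p => Subtype.ext <| by
        change φ p.1 (m (1, p)) = p.1
        rw [show m (1, p) = f p.1 by simp [m]]
        exact h2 _ (hD p _ le_rfl p.2.2) }
  let e : ContinuousMap.HomotopyEquiv (Fiber f P i.succ) (Slab f P i) :=
    { toFun := inclRight f P i
      invFun := r
      left_inv := by
        have : r.comp (inclRight f P i) = ContinuousMap.id _ := by
          ext p
          change φ p.1 (P.s i.succ) = p.1
          have h3 := h2 p.1 (hD (inclRight f P i p) _ le_rfl p.2.le)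
          rwa [p.2] at h3
        rw [this]
      right_inv := ⟨F⟩ }
  exact (FundamentalGroupoidFunctor.equivOfHomotopyEquiv e).isEquivalence_functor

/-- If one can move downwards in a slab, then the slab retracts onto its lower fibre. -/
theorem isEquivalence_map_inclLeft (hf : Continuous f)
    (h : HasLift f (downMoves (P.s i.castSucc) (P.s i.succ))) :
    (FundamentalGroupoid.map (inclLeft f P i)).IsEquivalence := by
  obtain ⟨φ, hc, h1, h2⟩ := h
  have hD : ∀ (p : Slab f P i) (t : ℝ), t ≤ f p → P.s i.castSucc ≤ t →
    (f p.1, t) ∈ downMoves (P.s i.castSucc) (P.s i.succ) := fun p t ht ht' => ⟨ht', ht, p.2.2⟩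
  let r : C(Slab f P i, Fiber f P i.castSucc) :=
    ⟨fun p => ⟨φ p.1 (P.s i.castSucc), h1 _ _ (hD p _ p.2.1 le_rfl)⟩,
      (hc.comp_continuous (f := fun p : Slab f P i => (p.1, P.s i.castSucc)) (by fun_prop)
        fun p => hD p _ p.2.1 le_rfl).subtype_mk _⟩
  let m : unitInterval × Slab f P i → ℝ := fun z =>
    (1 - (z.1 : ℝ)) * P.s i.castSucc + z.1 * f z.2
  have hm : ∀ z, m z ≤ f z.2 ∧ P.s i.castSucc ≤ m z := fun z => by
    have h0 := z.1.2.1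
    have h3 := z.1.2.2
    have h4 := z.2.2.1
    constructor <;> dsimp only [m] <;> nlinarith
  have hmD : ∀ z, (f z.2.1, m z) ∈ downMoves (P.s i.castSucc) (P.s i.succ) :=
    fun z => hD z.2 _ (hm z).1 (hm z).2
  have hmc : Continuous m := by fun_prop
  have hFc : Continuous fun z : unitInterval × Slab f P i => φ z.2.1 (m z) :=
    hc.comp_continuous (f := fun z : unitInterval × Slab f P i => (z.2.1, m z)) (by fun_prop) hmD
  have hFm : ∀ z : unitInterval × Slab f P i, f (φ z.2.1 (m z)) ∈ P.piece i := fun z => by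
    rw [h1 _ _ (hmD z)]
    exact ⟨(hm z).2, (hm z).1.trans z.2.2.2⟩
  let F : ((inclLeft f P i).comp r).Homotopy (ContinuousMap.id _) :=
    { toFun := fun z => ⟨φ z.2.1 (m z), hFm z⟩
      continuous_toFun := hFc.subtype_mk _
      map_zero_left := fun p => Subtype.ext <| by
        change φ p.1 (m (0, p)) = φ p.1 (P.s i.castSucc)
        simp [m]
      map_one_left := fun p => Subtype.ext <| by
        change φ p.1 (m (1, p)) = p.1
        rw [show m (1, p) = f p.1 by simp [m]]
        exact h2 _ (hD p _ le_rfl p.2.1) }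
  let e : ContinuousMap.HomotopyEquiv (Fiber f P i.castSucc) (Slab f P i) :=
    { toFun := inclLeft f P i
      invFun := r
      left_inv := by
        have : r.comp (inclLeft f P i) = ContinuousMap.id _ := by
          ext p
          change φ p.1 (P.s i.castSucc) = p.1
          have h3 := h2 p.1 (hD (inclLeft f P i p) _ le_rfl p.2.ge)
          rwa [p.2] at h3
        rw [this]
      right_inv := ⟨F⟩ }
  exact (FundamentalGroupoidFunctor.equivOfHomotopyEquiv e).isEquivalence_functor

/-- The class of a path in a slab from its lower to its upper fibre, as a morphism between the
values of the functors induced by the two inclusions. -/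
def slabHom {x : Fiber f P i.castSucc} {y : Fiber f P i.succ}
    (p : Path (inclLeft f P i x) (inclRight f P i y)) :
    (FundamentalGroupoid.map (inclLeft f P i)).obj (.mk x) ⟶
      (FundamentalGroupoid.map (inclRight f P i)).obj (.mk y) :=
  pathClass p

namespace SectionSpace

/-- The path in a slab given by a section which is defined there. -/
def slabPath (P : IntervalPartition a b n) (σ : SectionSpace f a' b') (i : Fin n)
    (hl : P.s i.castSucc ∈ Icc a' b') (hr : P.s i.succ ∈ Icc a' b') :
    Path (inclLeft f P i (evalAt f hl σ)) (inclRight f P i (evalAt f hr σ)) where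
  toFun t := ⟨σ.1 ⟨P.param i t, Icc_subset_Icc hl.1 hr.2 (P.param_mem_piece i t)⟩, by
    rw [σ.2]; exact P.param_mem_piece i t⟩
  continuous_toFun := by
    refine Continuous.subtype_mk (σ.1.continuous.comp (Continuous.subtype_mk ?_ _)) _
    unfold IntervalPartition.param
    fun_prop
  source' := by
    apply Subtype.ext
    simp [IntervalPartition.param, inclLeft, evalAt]
  target' := by
    apply Subtype.ext
    simp [IntervalPartition.param, inclRight, evalAt]

/-- Along a path of sections, the paths given in a slab are homotopic relative to the motion of
their end points. -/
theorem slabPath_naturality {σ τ : SectionSpace f a' b'} (H : Path σ τ) (i : Fin n)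
    (hl : P.s i.castSucc ∈ Icc a' b') (hr : P.s i.succ ∈ Icc a' b') :
    (FundamentalGroupoid.map (inclLeft f P i)).map
        (pathClass (H.map (evalAt f hl).continuous)) ≫ slabHom (slabPath P τ i hl hr) =
      slabHom (slabPath P σ i hl hr) ≫ (FundamentalGroupoid.map (inclRight f P i)).map
        (pathClass (H.map (evalAt f hr).continuous)) := by
  have hc : Continuous fun z : unitInterval × unitInterval =>
      (H z.1).1 ⟨P.param i z.2, Icc_subset_Icc hl.1 hr.2 (P.param_mem_piece i z.2)⟩ := by
    have : Continuous fun z : unitInterval × unitInterval => (⟨P.param i z.2,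
        Icc_subset_Icc hl.1 hr.2 (P.param_mem_piece i z.2)⟩ : Icc a' b') := by
      unfold IntervalPartition.param
      fun_prop
    fun_prop
  refine pathClass_square ⟨fun z => (slabPath P (H z.1) i hl hr) z.2, hc.subtype_mk _⟩ _ _ _ _
    (fun s => (slabPath P (H s) i hl hr).source) ?_ ?_
    (fun s => (slabPath P (H s) i hl hr).target)
  · intro t
    change (slabPath P (H 1) i hl hr) t = _
    rw [H.target]
  · intro t
    change (slabPath P (H 0) i hl hr) t = _
    rw [H.source]

end SectionSpace

end Slab

/-! ### Sections and sequential paths -/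

section Induction

open SectionSpace

variable {X : Type u} [TopologicalSpace X] {f : X → ℝ} {a b : ℝ} {n : ℕ}

/-- In each slab one can move upwards, or else one can move downwards, also just below it. -/
def IntervalPartition.IsLiftable (f : X → ℝ) (P : IntervalPartition a b n) : Prop :=
  ∀ i : Fin n, HasLift f (upMoves (P.s i.castSucc) (P.s i.succ)) ∨
    (HasLift f (downMoves (P.s i.castSucc) (P.s i.succ)) ∧ IsFlexible f a (P.s i.castSucc))

variable {P : IntervalPartition a b n}

theorem groupoid_comp_inv_comp {G : Type*} [Groupoid G] {x y z : G} (p : x ⟶ y) (q : x ⟶ z) :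
    p ≫ Groupoid.inv p ≫ q = q := by simp

theorem functor_square_of_eq {A G : Type*} [Groupoid A] [Groupoid G] {L : A ⥤ G} {x y z : A}
    {x' z' : G} {q : x ⟶ y} {w : y ⟶ z} {p : x ⟶ z} {s : L.obj x ⟶ x'} {r : x' ⟶ z'}
    {t : L.obj z ⟶ z'} (hp : L.map p = s ≫ r ≫ Groupoid.inv t) (hw : w = Groupoid.inv q ≫ p) :
    L.map (q ≫ w) ≫ t = s ≫ r := by
  rw [hw, groupoid_comp_inv_comp, hp]
  simp

theorem eq_of_functor_square_right {B G : Type*} [Category* B] [Groupoid G] {R : B ⥤ G}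
    [R.Faithful] {x' y' : B} {x y : G} {p : x ⟶ R.obj x'} {p' : y ⟶ R.obj y'} {q : x ⟶ y}
    {r r' : x' ⟶ y'} (h : q ≫ p' = p ≫ R.map r) (h' : q ≫ p' = p ≫ R.map r') : r = r' :=
  R.map_injective ((cancel_epi p).1 (h.symm.trans h'))

theorem eq_of_functor_square_left {A G : Type*} [Category* A] [Groupoid G] {L : A ⥤ G}
    [L.Faithful] {x y : A} {x' y' : G} {p : L.obj x ⟶ x'} {p' : L.obj y ⟶ y'} {q q' : x ⟶ y}
    {r : x' ⟶ y'} (h : L.map q ≫ p' = p ≫ r) (h' : L.map q' ≫ p' = p ≫ r) : q = q' :=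
  L.map_injective ((cancel_mono p').1 (h.trans h'.symm))

/-- Pasting of two adjacent squares between functors with the same target. -/
theorem functor_square_comp {A B G : Type*} [Category* A] [Category* B] [Category* G]
    {L : A ⥤ G} {R : B ⥤ G} {x y z : A} {x' y' z' : B} {p : L.obj x ⟶ R.obj x'}
    {p' : L.obj y ⟶ R.obj y'} {p'' : L.obj z ⟶ R.obj z'} {q : x ⟶ y} {r : y ⟶ z} {q' : x' ⟶ y'}
    {r' : y' ⟶ z'} (h : L.map q ≫ p' = p ≫ R.map q') (h' : L.map r ≫ p'' = p' ≫ R.map r') :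
    L.map (q ≫ r) ≫ p'' = p ≫ R.map (q' ≫ r') := by
  rw [L.map_comp, R.map_comp, Category.assoc, h', ← Category.assoc, h, Category.assoc]

/-- A section `σ` over an interval realizes the part of a sequential path `δ` over this interval:
the points of `δ` are connected to the values of `σ` by paths `q` in the fibres which carry the
paths of `δ` to those given by `σ`. -/
def Realizes {a' b' : ℝ} (δ : SequentialPath f P) (σ : SectionSpace f a' b') : Prop :=
  ∃ q : ∀ (i : Fin (n + 1)) (hi : P.s i ∈ Icc a' b'),
      FundamentalGroupoid.mk (δ.pt i) ⟶ FundamentalGroupoid.mk (evalAt f hi σ),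
    ∀ (i : Fin n) (hl : P.s i.castSucc ∈ Icc a' b') (hr : P.s i.succ ∈ Icc a' b'),
      (FundamentalGroupoid.map (inclLeft f P i)).map (q i.castSucc hl) ≫
          slabHom (slabPath P σ i hl hr) =
        slabHom (δ.path i) ≫ (FundamentalGroupoid.map (inclRight f P i)).map (q i.succ hr)

theorem IntervalPartition.mem_Icc_iff_le {P : IntervalPartition a b n} {i k : Fin (n + 1)} :
    P.s i ∈ Icc a (P.s k) ↔ i ≤ k :=
  ⟨fun h => P.strictMono.le_iff_le.1 h.2, fun h => ⟨(P.mem_Icc i).1, P.strictMono.monotone h⟩⟩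

/-- A section over `[a, s (i + 1)]` realizes a sequential path if it does so over `[a, s i]` and in
the next slab. -/
theorem Realizes.succ {δ : SequentialPath f P} {i : Fin n}
    (hl : P.s i.castSucc ∈ Icc a (P.s i.succ))
    (hr : P.s i.succ ∈ Icc a (P.s i.succ)) (σ : SectionSpace f a (P.s i.succ))
    (q : ∀ (j : Fin (n + 1)) (hj : P.s j ∈ Icc a (P.s i.castSucc)),
      FundamentalGroupoid.mk (δ.pt j) ⟶
        FundamentalGroupoid.mk (evalAt f hj (res f (Icc_subset_Icc_right hl.2) σ)))
    (hq : ∀ (j : Fin n) (hl' : P.s j.castSucc ∈ Icc a (P.s i.castSucc))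
      (hr' : P.s j.succ ∈ Icc a (P.s i.castSucc)),
      (FundamentalGroupoid.map (inclLeft f P j)).map (q j.castSucc hl') ≫
          slabHom (slabPath P (res f (Icc_subset_Icc_right hl.2) σ) j hl' hr') =
        slabHom (δ.path j) ≫ (FundamentalGroupoid.map (inclRight f P j)).map (q j.succ hr'))
    (q' : FundamentalGroupoid.mk (δ.pt i.succ) ⟶ FundamentalGroupoid.mk (evalAt f hr σ))
    (hq' : (FundamentalGroupoid.map (inclLeft f P i)).map (q i.castSucc ⟨hl.1, le_rfl⟩) ≫
          slabHom (slabPath P σ i hl hr) =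
        slabHom (δ.path i) ≫ (FundamentalGroupoid.map (inclRight f P i)).map q') :
    Realizes δ σ := by
  have hlt : ∀ j : Fin (n + 1), P.s j ∈ Icc a (P.s i.succ) → j ≠ i.succ →
      P.s j ∈ Icc a (P.s i.castSucc) := fun j hj hne =>
    IntervalPartition.mem_Icc_iff_le.2 (Fin.le_castSucc_iff.2
      (lt_of_le_of_ne (IntervalPartition.mem_Icc_iff_le.1 hj) hne))
  let Q : ∀ (j : Fin (n + 1)) (hj : P.s j ∈ Icc a (P.s i.succ)),
      FundamentalGroupoid.mk (δ.pt j) ⟶ FundamentalGroupoid.mk (evalAt f hj σ) :=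
    fun j hj => if h : j = i.succ then by subst h; exact q' else q j (hlt j hj h)
  have hQ : Q i.succ hr = q' := dif_pos rfl
  have hQ' : ∀ j hj (h : j ≠ i.succ), Q j hj = q j (hlt j hj h) := fun j hj h => dif_neg h
  clear_value Q
  refine ⟨Q, fun j hjl hjr => ?_⟩
  have h1 : j.castSucc ≠ i.succ := fun h =>
    absurd (IntervalPartition.mem_Icc_iff_le.1 hjr) (by
      rw [← h]; exact not_le.2 Fin.castSucc_lt_succ)
  rw [hQ' _ _ h1]
  by_cases hji : j = i
  · subst hji
    rw [hQ]
    exact hq'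
  · rw [hQ' _ _ fun h => hji (Fin.succ_injective _ h)]
    exact hq j _ _

/-- Over `[a, s k]` every sequential path is realized by a section, by induction on `k`. -/
theorem exists_realizes_aux (hf : Continuous f) (hP : P.IsLiftable f) (δ : SequentialPath f P)
    (k : Fin (n + 1)) : ∃ σ : SectionSpace f a (P.s k), Realizes δ σ := by
  induction k using Fin.induction with
  | zero =>
    have h0 : ∀ i, P.s i ∈ Icc a (P.s 0) → i = 0 := fun i hi =>
      le_antisymm (IntervalPartition.mem_Icc_iff_le.1 hi) (Fin.zero_le i)
    refine ⟨⟨ContinuousMap.const _ (δ.pt 0).1, fun t => ?_⟩, fun i hi => ?_, ?_⟩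
    · exact (δ.pt 0).2.trans (le_antisymm (P.first.trans_le t.2.1) t.2.2)
    · have := h0 i hi
      subst this
      exact 𝟙 _
    · intro i _ hr
      exact absurd (h0 _ hr) (Fin.succ_ne_zero i)
  | succ i ih =>
    obtain ⟨σ, q, hq⟩ := ih
    have hl : P.s i.castSucc ∈ Icc a (P.s i.succ) :=
      IntervalPartition.mem_Icc_iff_le.2 Fin.castSucc_lt_succ.le
    have hr : P.s i.succ ∈ Icc a (P.s i.succ) := IntervalPartition.mem_Icc_iff_le.2 le_rfl
    have hl₀ : P.s i.castSucc ∈ Icc a (P.s i.castSucc) := IntervalPartition.mem_Icc_iff_le.2 le_rfl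
    rcases hP i with h | ⟨h, hflex⟩
    · -- extend the section by moving upwards
      obtain ⟨Θ, hΘ, -⟩ := exists_contraction_of_up hl.2 h
      obtain ⟨g, hg⟩ := exists_glue (Y := Unit) hl.1 hl.2 (ContinuousMap.const _ σ)
        (ContinuousMap.const _ (Θ (evalAt f hl₀ σ))) (fun _ => (hΘ _).symm)
      obtain ⟨h1, h2⟩ := hg ()
      dsimp only [ContinuousMap.const_apply] at h1
      generalize g () = σ' at h1
      subst h1
      have := isEquivalence_map_inclRight hf h
      refine ⟨σ', Realizes.succ hl hr σ' q hq
        ((FundamentalGroupoid.map (inclRight f P i)).preimage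
          (Groupoid.inv (slabHom (δ.path i)) ≫
            (FundamentalGroupoid.map (inclLeft f P i)).map (q i.castSucc hl₀) ≫
              slabHom (slabPath P σ' i hl hr))) ?_⟩
      rw [Functor.map_preimage]
      exact (groupoid_comp_inv_comp _ _).symm
    · -- move downwards from the next point, and move the end of `σ` to the point reached
      obtain ⟨Θ, hΘ, -⟩ := exists_contraction_of_down hl.2 h
      set ρ := Θ (δ.pt i.succ) with hρ
      have hl₁ : P.s i.castSucc ∈ Icc (P.s i.castSucc) (P.s i.succ) := left_mem_Icc.2 hl.2
      have hr₁ : P.s i.succ ∈ Icc (P.s i.castSucc) (P.s i.succ) := right_mem_Icc.2 hl.2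
      let r : FundamentalGroupoid.mk (δ.pt i.succ) ⟶ FundamentalGroupoid.mk (evalAt f hr₁ ρ) :=
        eqToHom (congrArg FundamentalGroupoid.mk (hΘ _).symm)
      clear_value ρ r
      have := isEquivalence_map_inclLeft hf h
      obtain ⟨p, hp⟩ := (FundamentalGroupoid.map (inclLeft f P i)).map_surjective
        (slabHom (δ.path i) ≫ (FundamentalGroupoid.map (inclRight f P i)).map r ≫
          Groupoid.inv (slabHom (slabPath P ρ i hl₁ hr₁)))
      obtain ⟨w, hw⟩ := exists_pathClass_eq (Groupoid.inv (q i.castSucc hl₀) ≫ p)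
      obtain ⟨σ₁, H, hH⟩ := exists_path_of_flexible hl.1 hflex σ w
      have hend : evalAt f hl₁ ρ = evalAt f hl₀ σ₁ := by
        have := hH 1
        rw [H.target, w.target] at this
        exact this.symm
      obtain ⟨g, hg⟩ := exists_glue (Y := Unit) hl.1 hl.2 (ContinuousMap.const _ σ₁)
        (ContinuousMap.const _ ρ) (fun _ => hend.symm)
      obtain ⟨h1, h2⟩ := hg ()
      dsimp only [ContinuousMap.const_apply] at h1 h2
      generalize g () = σ' at h1 h2
      subst h1 h2
      have hHw : H.map (evalAt f hl₀).continuous = w := Path.ext (funext hH)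
      refine ⟨σ', Realizes.succ hl hr σ'
        (fun j hj => q j hj ≫ pathClass (H.map (evalAt f hj).continuous)) ?_ r ?_⟩
      · intro j hl' hr'
        have hnat := slabPath_naturality (P := P) H j hl' hr'
        exact functor_square_comp (hq j hl' hr') hnat
      · exact functor_square_of_eq hp ((congrArg pathClass hHw).trans hw)

/-- Every sequential path is realized by a section. -/
theorem exists_realizes (hf : Continuous f) (hP : P.IsLiftable f) (δ : SequentialPath f P) :
    ∃ σ : SectionSpace f a b, Realizes δ σ := by
  obtain ⟨σ, q, hq⟩ := exists_realizes_aux hf hP δ (Fin.last n)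
  have hs : Icc a b ⊆ Icc a (P.s (Fin.last n)) := Icc_subset_Icc_right P.last.ge
  exact ⟨res f hs σ, fun i hi => q i (hs hi), fun i hl hr => hq i (hs hl) (hs hr)⟩

/-- The inductive form of `joined_of_naturality`: the path of sections over `[a, s k]` also induces
the given class of paths at the last level `s k`, along which it is glued in the next step. -/
theorem exists_path_of_naturality_aux (hf : Continuous f) (hP : P.IsLiftable f)
    (σ τ : SectionSpace f a b)
    (q : ∀ i, FundamentalGroupoid.mk (evalAt f (P.mem_Icc i) σ) ⟶
      FundamentalGroupoid.mk (evalAt f (P.mem_Icc i) τ))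
    (hq : ∀ i : Fin n, (FundamentalGroupoid.map (inclLeft f P i)).map (q i.castSucc) ≫
          slabHom (slabPath P τ i (P.mem_Icc _) (P.mem_Icc _)) =
        slabHom (slabPath P σ i (P.mem_Icc _) (P.mem_Icc _)) ≫
          (FundamentalGroupoid.map (inclRight f P i)).map (q i.succ))
    (k : Fin (n + 1)) :
    ∃ H : Path (res f (Icc_subset_Icc_right (P.mem_Icc k).2) σ)
        (res f (Icc_subset_Icc_right (P.mem_Icc k).2) τ),
      pathClass (H.map (evalAt f (right_mem_Icc.2 (P.mem_Icc k).1)).continuous) = q k := by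
  induction k using Fin.induction with
  | zero =>
    obtain ⟨w, hw⟩ := exists_pathClass_eq (q 0)
    have h0 : ∀ t : Icc a (P.s 0), (t : ℝ) = P.s 0 := fun t =>
      le_antisymm t.2.2 (P.first.trans_le t.2.1)
    let g := family (f := f) (fun z : unitInterval × Icc a (P.s 0) => (w z.1).1)
      (by fun_prop) (fun s t => (w s).2.trans (h0 t).symm)
    refine ⟨⟨g, ?_, ?_⟩, ?_⟩
    · apply Subtype.ext
      ext t
      have ht : t = ⟨P.s 0, right_mem_Icc.2 (P.mem_Icc 0).1⟩ := Subtype.ext (h0 t)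
      subst ht
      exact congrArg Subtype.val w.source
    · apply Subtype.ext
      ext t
      have ht : t = ⟨P.s 0, right_mem_Icc.2 (P.mem_Icc 0).1⟩ := Subtype.ext (h0 t)
      subst ht
      exact congrArg Subtype.val w.target
    · rw [← hw]
      rfl
  | succ i ih =>
    obtain ⟨H, hH⟩ := ih
    have hle := P.castSucc_le_succ i
    have hl : P.s i.castSucc ∈ Icc a (P.s i.succ) :=
      IntervalPartition.mem_Icc_iff_le.2 Fin.castSucc_lt_succ.le
    have hr : P.s i.succ ∈ Icc a (P.s i.succ) := IntervalPartition.mem_Icc_iff_le.2 le_rfl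
    have hl₀ : P.s i.castSucc ∈ Icc a (P.s i.castSucc) := IntervalPartition.mem_Icc_iff_le.2 le_rfl
    have hl₁ : P.s i.castSucc ∈ Icc (P.s i.castSucc) (P.s i.succ) := left_mem_Icc.2 hl.2
    have hr₁ : P.s i.succ ∈ Icc (P.s i.castSucc) (P.s i.succ) := right_mem_Icc.2 hl.2
    have hslab : Icc (P.s i.castSucc) (P.s i.succ) ⊆ Icc a b := P.piece_subset i
    rcases hP i with h | ⟨h, hflex⟩
    · obtain ⟨Θ, hΘ, hΘ'⟩ := exists_contraction_of_up hle h
      obtain ⟨C, hC⟩ := hΘ' (res f hslab σ)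
      obtain ⟨D, hD⟩ := hΘ' (res f hslab τ)
      let w := H.map (evalAt f hl₀).continuous
      -- over the slab, the path of sections moves upwards from the points of the path `w`
      let K : Path (res f hslab σ) (res f hslab τ) :=
        C.symm.trans ((w.map Θ.continuous).trans D)
      let H' := (Path.refl _).trans (H.trans (Path.refl _))
      have hHK : ∀ s, evalAt f hl₀ (H' s) = evalAt f hl₁ (K s) := by
        refine apply_trans_congr (evalAt f hl₀) (evalAt f hl₁) _ _ _ _ (fun s => ?_)
          (apply_trans_congr _ _ _ _ _ _ (fun s => ?_) fun s => ?_)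
        · exact (hC _).symm
        · exact (hΘ _).symm
        · exact (hD _).symm
      obtain ⟨L, hL⟩ := exists_glue_path hl.1 hle
        (σ := res f (Icc_subset_Icc_right (P.mem_Icc i.succ).2) σ)
        (τ := res f (Icc_subset_Icc_right (P.mem_Icc i.succ).2) τ) H' K hHK
      refine ⟨L, ?_⟩
      have hLl : pathClass (L.map (evalAt f hl).continuous) = q i.castSucc := by
        have e1 : L.map (evalAt f hl).continuous = H'.map (evalAt f hl₀).continuous :=
          Path.ext (funext fun s => congrArg (evalAt f hl₀) (hL s).1)
        exact (congrArg pathClass e1).trans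
          ((pathClass_map_refl_trans_trans_refl (evalAt f hl₀) H).trans hH)
      -- as the upper fibre is equivalent to the slab, the class at the upper level is determined
      have := isEquivalence_map_inclRight hf h
      have hnat := slabPath_naturality (P := P) L i hl hr
      rw [hLl] at hnat
      exact eq_of_functor_square_right hnat (hq i)
    · obtain ⟨Θ, hΘ, hΘ'⟩ := exists_contraction_of_down hle h
      obtain ⟨C, hC⟩ := hΘ' (res f hslab σ)
      obtain ⟨D, hD⟩ := hΘ' (res f hslab τ)
      obtain ⟨w, hw⟩ : ∃ w : Path (evalAt f hr₁ (res f hslab σ)) (evalAt f hr₁ (res f hslab τ)),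
        pathClass w = q i.succ := exists_pathClass_eq (q i.succ)
      obtain ⟨K, hKr⟩ : ∃ K : Path (res f hslab σ) (res f hslab τ),
          pathClass (K.map (evalAt f hr₁).continuous) = pathClass w :=
        ⟨_, pathClass_map_conj_section (evalAt f hr₁) Θ hΘ w C D hC hD⟩
      replace hKr := hKr.trans hw
      have hnat := slabPath_naturality (P := P) K i hl₁ hr₁
      have := isEquivalence_map_inclLeft hf h
      -- the paths of sections over `[a, s i]` and over the slab move the value at `s i` along
      -- homotopic paths
      have hKl : pathClass (K.map (evalAt f hl₁).continuous) = q i.castSucc := by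
        rw [hKr] at hnat
        exact eq_of_functor_square_left hnat (hq i)
      obtain ⟨H', hH'⟩ := exists_path_of_flexible_of_homotopic hl.1 hflex H
        (K.map (evalAt f hl₁).continuous) (pathClass_eq_iff.1 (hH.trans hKl.symm))
      let K' := K.reparam pause continuous_pause pause_zero pause_one
      obtain ⟨L, hL⟩ := exists_glue_path hl.1 hle
        (σ := res f (Icc_subset_Icc_right (P.mem_Icc i.succ).2) σ)
        (τ := res f (Icc_subset_Icc_right (P.mem_Icc i.succ).2) τ) H' K' hH'
      refine ⟨L, ?_⟩
      rw [← hKr]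
      have e1 : L.map (evalAt f hr).continuous = (K.map (evalAt f hr₁).continuous).reparam pause
          continuous_pause pause_zero pause_one :=
        Path.ext (funext fun s => congrArg (evalAt f hr₁) (hL s).2)
      refine Eq.trans (congrArg _ e1) (pathClass_eq_iff.2 ?_)
      exact ⟨(Path.Homotopy.reparam _ _ _ _ _).symm⟩

/-- Two sections are connected by a path of sections as soon as their values at the points of the
partition are connected, compatibly with the paths they give in the slabs. -/
theorem joined_of_naturality (hf : Continuous f) (hP : P.IsLiftable f)
    (σ τ : SectionSpace f a b)
    (q : ∀ i, FundamentalGroupoid.mk (evalAt f (P.mem_Icc i) σ) ⟶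
      FundamentalGroupoid.mk (evalAt f (P.mem_Icc i) τ))
    (hq : ∀ i : Fin n, (FundamentalGroupoid.map (inclLeft f P i)).map (q i.castSucc) ≫
          slabHom (slabPath P τ i (P.mem_Icc _) (P.mem_Icc _)) =
        slabHom (slabPath P σ i (P.mem_Icc _) (P.mem_Icc _)) ≫
          (FundamentalGroupoid.map (inclRight f P i)).map (q i.succ)) : Joined σ τ := by
  obtain ⟨H, -⟩ := exists_path_of_naturality_aux hf hP σ τ q hq (Fin.last n)
  exact ⟨H.map (res f (Icc_subset_Icc_right P.last.ge)).continuous⟩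

end Induction

/-! ### The derived limit of a diagram of groups over a zigzag -/

section ZigzagLimit

variable {n : ℕ} {F : Zigzag n ⥤ GrpCat.{u}}

theorem LimCocycle.apply_id {C : Type} [SmallCategory C] {F : C ⥤ GrpCat.{u}} (z : LimCocycle F)
    (a : C) : z.1 a a (𝟙 a) = 1 := by
  have h := z.2 a a a (𝟙 a) (𝟙 a)
  rw [F.map_id, Category.comp_id] at h
  exact left_eq_mul.1 h

theorem GluingOrbits.mk_eq_mk_iff {h h' : ∀ i : Fin n, F.obj (.seg i)} :
    GluingOrbits.mk F h = GluingOrbits.mk F h' ↔ ∃ g : ∀ i : Fin (n + 1), F.obj (.pt i), ∀ i,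
      F.map (Zigzag.right i) (g i.succ) * h' i * (F.map (Zigzag.left i) (g i.castSucc))⁻¹ =
        h i := by
  let _ := gluingAction F
  refine Quotient.eq.trans ?_
  exact exists_congr fun g => funext_iff

/-- The elements of the groups over the segments to which a cocycle amounts. -/
def LimCocycle.toGluing (z : LimCocycle F) (i : Fin n) : F.obj (.seg i) :=
  (z.1 _ _ (Zigzag.right i))⁻¹ * z.1 _ _ (Zigzag.left i)

/-- The cocycle with given values at the arrows from the left, and trivial values at the arrows from
the right. -/
def LimCocycle.ofGluing (h : ∀ i : Fin n, F.obj (.seg i)) : LimCocycle F :=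
  ⟨fun _ b f => match b, f with
    | _, .id _ => 1
    | _, .left i => h i
    | _, .right _ => 1, by
    intro a b c f g
    change Zigzag.Hom a b at f
    change Zigzag.Hom b c at g
    cases f with
    | id => cases g <;> exact ((congrArg _ (map_one _)).trans (mul_one _)).symm
    | left i =>
      cases g
      refine ((one_mul _).trans ?_).symm
      exact congrArg (fun φ : F.obj (.seg i) ⟶ F.obj (.seg i) => φ (h i)) (F.map_id (.seg i))
    | right i =>
      cases g
      exact ((congrArg _ (map_one _)).trans (mul_one _)).symm⟩

theorem LimCocycle.toGluing_ofGluing (h : ∀ i : Fin n, F.obj (.seg i)) :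
    (LimCocycle.ofGluing h).toGluing = h := by
  funext i
  change (1 : F.obj (.seg i))⁻¹ * h i = h i
  simp

theorem LimCocycle.mk_toGluing_eq_iff (z w : LimCocycle F) :
    GluingOrbits.mk F w.toGluing = GluingOrbits.mk F z.toGluing ↔ limCocycleSetoid F z w := by
  rw [GluingOrbits.mk_eq_mk_iff]
  constructor
  · rintro ⟨g, hg⟩
    have key : ∀ i : Fin n, w.1 _ _ (Zigzag.left i) =
        (w.1 _ _ (Zigzag.right i) * F.map (Zigzag.right i) (g i.succ) *
          (z.1 _ _ (Zigzag.right i))⁻¹) * z.1 _ _ (Zigzag.left i) *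
            (F.map (Zigzag.left i) (g i.castSucc))⁻¹ := fun i => by
      have := hg i
      rw [toGluing, toGluing, eq_inv_mul_iff_mul_eq] at this
      rw [← this]
      simp only [mul_assoc]
    refine ⟨fun a => match a with
      | .pt i => g i
      | .seg i => w.1 _ _ (Zigzag.right i) * F.map (Zigzag.right i) (g i.succ) *
          (z.1 _ _ (Zigzag.right i))⁻¹, fun a b f => ?_⟩
    change Zigzag.Hom a b at f
    cases f with
    | id =>
      change w.1 a a (𝟙 a) = _ * z.1 a a (𝟙 a) * (F.map (𝟙 a) _)⁻¹
      rw [w.apply_id, z.apply_id, F.map_id]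
      simp
    | left i => exact key i
    | right i =>
      change w.1 _ _ (Zigzag.right i) = _ * _ * _ * z.1 _ _ (Zigzag.right i) *
        (F.map (Zigzag.right i) (g i.succ))⁻¹
      simp
  · rintro ⟨h, hh⟩
    refine ⟨fun i => h (.pt i), fun i => ?_⟩
    rw [toGluing, toGluing, hh _ _ (Zigzag.right i), hh _ _ (Zigzag.left i)]
    simp [mul_assoc]

/-- The derived limit of a diagram of groups over a zigzag as a set of orbits. -/
noncomputable def derivedLimEquiv (F : Zigzag n ⥤ GrpCat.{u}) : DerivedLim F ≃ GluingOrbits F :=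
  Equiv.ofBijective
    (Quotient.lift (fun z : LimCocycle F => GluingOrbits.mk F z.toGluing) fun z w h =>
      ((LimCocycle.mk_toGluing_eq_iff z w).2 h).symm) (by
    constructor
    · rintro ⟨z⟩ ⟨w⟩ h
      exact Quotient.sound ((LimCocycle.mk_toGluing_eq_iff z w).1 h.symm)
    · rintro ⟨h⟩
      exact ⟨DerivedLim.mk F (LimCocycle.ofGluing h),
        congrArg (GluingOrbits.mk F) (LimCocycle.toGluing_ofGluing h)⟩)

end ZigzagLimit

/-! ### Classification of sections up to homotopy -/

section Classification

open SectionSpace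

variable {X : Type u} [TopologicalSpace X] {f : X → ℝ} {a b : ℝ} {n : ℕ}
  {P : IntervalPartition a b n}

theorem ZerothHomotopy.mk_eq_mk_iff {Z : Type*} [TopologicalSpace Z] {x y : Z} :
    ZerothHomotopy.mk x = ZerothHomotopy.mk y ↔ Joined x y :=
  Quotient.eq

theorem SequentialPath.toLim_surjective :
    Function.Surjective (SequentialPath.toLim : SequentialPath f P → LimPiZero f P) := by
  intro x
  choose p hp using fun i : Fin (n + 1) =>
    ZerothHomotopy.mk_surjective (X := Fiber f P i) (x.1 (.pt i))
  have hl : ∀ i : Fin n, ZerothHomotopy.mk (inclLeft f P i (p i.castSucc)) = x.1 (.seg i) :=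
    fun i => by
      refine Eq.trans ?_ (x.2 (Zigzag.left i))
      rw [← hp]
      rfl
  have hr : ∀ i : Fin n, ZerothHomotopy.mk (inclRight f P i (p i.succ)) = x.1 (.seg i) :=
    fun i => by
      refine Eq.trans ?_ (x.2 (Zigzag.right i))
      rw [← hp]
      rfl
  refine ⟨⟨p, fun i => (ZerothHomotopy.mk_eq_mk_iff.1 ((hl i).trans (hr i).symm)).somePath⟩, ?_⟩
  apply Subtype.ext
  funext c
  cases c with
  | pt i => exact hp i
  | seg i => exact hl i

theorem SequentialPath.toLim_eq_iff {γ δ : SequentialPath f P} :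
    γ.toLim = δ.toLim ↔ ∀ i, Joined (γ.pt i) (δ.pt i) := by
  constructor
  · intro h i
    exact ZerothHomotopy.mk_eq_mk_iff.1 (congrArg (fun x : LimPiZero f P => x.1 (.pt i)) h)
  · intro h
    apply Subtype.ext
    funext c
    cases c with
    | pt i => exact ZerothHomotopy.mk_eq_mk_iff.2 (h i)
    | seg i =>
      exact ZerothHomotopy.mk_eq_mk_iff.2
        ⟨(h i.castSucc).somePath.map (inclLeft f P i).continuous⟩

theorem Realizes.joined {δ : SequentialPath f P} {σ : SectionSpace f a b} (h : Realizes δ σ)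
    (i : Fin (n + 1)) :
    Joined (δ.pt i) ((SequentialPath.ofSection σ : SequentialPath f P).pt i) := by
  obtain ⟨q, -⟩ := h
  exact ⟨(exists_pathClass_eq (q i (P.mem_Icc i))).choose⟩

theorem sectionsToLim_surjective (hf : Continuous f) (hP : P.IsLiftable f) :
    Function.Surjective (sectionsToLim f P) := by
  intro x
  obtain ⟨δ, rfl⟩ := SequentialPath.toLim_surjective x
  obtain ⟨σ, h⟩ := exists_realizes hf hP δ
  exact ⟨ZerothHomotopy.mk σ, (SequentialPath.toLim_eq_iff.2 h.joined).symm⟩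

/-- Gluing data `g` relate the difference loops `(q, s)` and `(q', t)`, both relative to `p`, if and
only if the paths `q⁻¹ g⁻¹ q'` carry `s` to `t`.  The left hand side is what `gluingAction` on
`piOne` and `difference` unfold to. -/
theorem groupoid_gluing_iff {A B G : Type*} [Groupoid A] [Groupoid B] [Groupoid G]
    {L : A ⥤ G} {R : B ⥤ G} {x y z : A} {x' y' z' : B} (p : L.obj x ⟶ R.obj x')
    (s : L.obj y ⟶ R.obj y') (t : L.obj z ⟶ R.obj z') (q : x ⟶ y) (q' : x ⟶ z) (g : x ⟶ x)
    (r : x' ⟶ y') (r' : x' ⟶ z') (g' : x' ⟶ x') {w : y ⟶ z} {w' : y' ⟶ z'}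
    (hw : w = Groupoid.inv q ≫ Groupoid.inv g ≫ q')
    (hw' : w' = Groupoid.inv r ≫ Groupoid.inv g' ≫ r') :
    Groupoid.inv (L.map g) ≫ (((L.map q' ≫ t) ≫ Groupoid.inv (R.map r')) ≫ Groupoid.inv p) ≫
        Groupoid.inv (Groupoid.inv p) ≫ R.map g' ≫ Groupoid.inv p =
      ((L.map q ≫ s) ≫ Groupoid.inv (R.map r)) ≫ Groupoid.inv p ↔
    L.map w ≫ t = s ≫ R.map w' := by
  subst hw hw'
  simp only [Groupoid.inv_eq_inv, Functor.map_comp, Functor.map_inv, IsIso.inv_inv]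
  constructor
  · intro h
    have := congrArg (fun k => inv (L.map q) ≫ k ≫ p ≫ inv (R.map g') ≫ R.map r') h
    simpa using this
  · intro h
    have := congrArg (fun k => L.map q ≫ k ≫ inv (R.map r') ≫ R.map g' ≫ inv p) h
    simpa using this

theorem groupoid_difference_eq {A B G : Type*} [Groupoid A] [Groupoid B] [Groupoid G]
    {L : A ⥤ G} {R : B ⥤ G} {x y : A} {x' y' : B} {p : L.obj x ⟶ R.obj x'}
    {s : L.obj y ⟶ R.obj y'} {q : x ⟶ y} {r : x' ⟶ y'} {l : L.obj x ⟶ L.obj x}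
    (h : L.map q ≫ s = (l ≫ p) ≫ R.map r) :
    ((L.map q ≫ s) ≫ Groupoid.inv (R.map r)) ≫ Groupoid.inv p = l := by
  rw [h]
  simp

/-- Two sections are homotopic if and only if their difference loops lie in the same orbit. -/
theorem mk_difference_eq_iff (hf : Continuous f) (hP : P.IsLiftable f) (γ : SequentialPath f P)
    (σ τ : SectionSpace f a b)
    (q : ∀ i, Path (γ.pt i) ((SequentialPath.ofSection σ : SequentialPath f P).pt i))
    (q' : ∀ i, Path (γ.pt i) ((SequentialPath.ofSection τ : SequentialPath f P).pt i)) :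
    GluingOrbits.mk γ.piOne (γ.difference (SequentialPath.ofSection σ) q) =
      GluingOrbits.mk γ.piOne (γ.difference (SequentialPath.ofSection τ) q') ↔ Joined σ τ := by
  rw [GluingOrbits.mk_eq_mk_iff]
  constructor
  · rintro ⟨g, hg⟩
    refine joined_of_naturality (P := P) hf hP σ τ (fun i => Groupoid.inv (pathClass (q i)) ≫
      Groupoid.inv (g i : FundamentalGroupoid.mk (γ.pt i) ⟶ .mk (γ.pt i)) ≫ pathClass (q' i)) ?_
    intro i
    exact (groupoid_gluing_iff (L := FundamentalGroupoid.map (inclLeft f P i))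
      (R := FundamentalGroupoid.map (inclRight f P i)) (slabHom (γ.path i)) _ _ _ _ _ _ _ _
      rfl rfl).1 (hg i)
  · rintro ⟨H⟩
    let r : ∀ i, FundamentalGroupoid.mk ((SequentialPath.ofSection σ : SequentialPath f P).pt i) ⟶
      .mk ((SequentialPath.ofSection τ : SequentialPath f P).pt i) := fun i =>
        pathClass (H.map (evalAt f (P.mem_Icc i)).continuous)
    let g : ∀ i, FundamentalGroupoid.mk (γ.pt i) ⟶ .mk (γ.pt i) := fun i =>
      pathClass (q' i) ≫ Groupoid.inv (r i) ≫ Groupoid.inv (pathClass (q i))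
    have hr : ∀ i, r i = Groupoid.inv (pathClass (q i)) ≫ Groupoid.inv (g i) ≫ pathClass (q' i) :=
      fun i => by
        dsimp only [g]
        generalize r i = r₀
        generalize pathClass (q i) = q₀
        generalize pathClass (q' i) = q₁
        simp
    refine ⟨g, fun i => ?_⟩
    refine (groupoid_gluing_iff (L := FundamentalGroupoid.map (inclLeft f P i))
      (R := FundamentalGroupoid.map (inclRight f P i)) (slabHom (γ.path i))
      (slabHom (slabPath P σ i (P.mem_Icc _) (P.mem_Icc _)))
      (slabHom (slabPath P τ i (P.mem_Icc _) (P.mem_Icc _))) (pathClass (q i.castSucc))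
      (pathClass (q' i.castSucc)) (g i.castSucc) (pathClass (q i.succ)) (pathClass (q' i.succ))
      (g i.succ) (hr i.castSucc) (hr i.succ)).2 ?_
    exact slabPath_naturality H i _ _

/-- Each family of loops is the family of differences of some section. -/
theorem exists_difference_eq (hf : Continuous f) (hP : P.IsLiftable f) (γ : SequentialPath f P)
    (h : ∀ i : Fin n, γ.piOne.obj (.seg i)) :
    ∃ (σ : SectionSpace f a b)
      (q : ∀ i, Path (γ.pt i) ((SequentialPath.ofSection σ : SequentialPath f P).pt i)),
      γ.difference (SequentialPath.ofSection σ) q = h := by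
  choose l hl using fun i : Fin n => exists_pathClass_eq (Z := Slab f P i)
    (x := inclLeft f P i (γ.pt i.castSucc)) (y := inclLeft f P i (γ.pt i.castSucc)) (h i)
  -- realize the sequential path which goes around the loop `l i` before it follows `γ`
  let δ : SequentialPath f P := ⟨γ.pt, fun i => (l i).trans (γ.path i)⟩
  obtain ⟨σ, q, hq⟩ := exists_realizes hf hP δ
  choose q' hq' using fun i => exists_pathClass_eq (q i (P.mem_Icc i))
  refine ⟨σ, q', funext fun i => ?_⟩
  have h1 := hq i (P.mem_Icc _) (P.mem_Icc _)
  rw [← hq', ← hq'] at h1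
  exact (groupoid_difference_eq (L := FundamentalGroupoid.map (inclLeft f P i))
    (R := FundamentalGroupoid.map (inclRight f P i)) (p := slabHom (γ.path i)) h1).trans (hl i)

/-- The classification of sections, for partitions in whose slabs one can move upwards or
downwards. -/
theorem exists_classification (hf : Continuous f) (hP : P.IsLiftable f) (γ : SequentialPath f P) :
    ∃ (ι : DerivedLim γ.piOne → ZerothHomotopy (SectionSpace f a b))
      (o : DerivedLim γ.piOne ≃ GluingOrbits γ.piOne),
      Function.Injective ι ∧
      range ι = sectionsToLim f P ⁻¹' {γ.toLim} ∧
      (∀ z : LimCocycle γ.piOne, o (DerivedLim.mk γ.piOne z) =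
        GluingOrbits.mk γ.piOne (fun i =>
          (z.1 _ _ (Zigzag.right i))⁻¹ * z.1 _ _ (Zigzag.left i))) ∧
      (∀ (σ : SectionSpace f a b)
        (q : ∀ i, Path (γ.pt i) ((SequentialPath.ofSection σ : SequentialPath f P).pt i))
        (x : DerivedLim γ.piOne),
        ι x = ZerothHomotopy.mk σ ↔
          o x = GluingOrbits.mk γ.piOne (γ.difference (SequentialPath.ofSection σ) q)) := by
  have key : ∀ x : GluingOrbits γ.piOne, ∃ (σ : SectionSpace f a b)
      (q : ∀ i, Path (γ.pt i) ((SequentialPath.ofSection σ : SequentialPath f P).pt i)),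
      x = GluingOrbits.mk γ.piOne (γ.difference (SequentialPath.ofSection σ) q) := by
    rintro ⟨h⟩
    obtain ⟨σ, q, hq⟩ := exists_difference_eq hf hP γ h
    exact ⟨σ, q, by rw [hq]; rfl⟩
  choose S Q hSQ using key
  set o := derivedLimEquiv γ.piOne with ho
  have hι : ∀ (σ : SectionSpace f a b)
      (q : ∀ i, Path (γ.pt i) ((SequentialPath.ofSection σ : SequentialPath f P).pt i))
      (x : GluingOrbits γ.piOne), ZerothHomotopy.mk (S x) = ZerothHomotopy.mk σ ↔
        x = GluingOrbits.mk γ.piOne (γ.difference (SequentialPath.ofSection σ) q) := by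
    intro σ q x
    conv_rhs => lhs; rw [hSQ x]
    rw [ZerothHomotopy.mk_eq_mk_iff, mk_difference_eq_iff hf hP]
  refine ⟨fun x => ZerothHomotopy.mk (S (o x)), o, ?_, ?_, fun z => rfl, fun σ q x => hι σ q (o x)⟩
  · intro x y hxy
    apply o.injective
    exact ((hι _ (Q (o y)) (o x)).1 hxy).trans (hSQ (o y)).symm
  · ext c
    obtain ⟨σ, rfl⟩ := ZerothHomotopy.mk_surjective c
    have hσ : ZerothHomotopy.mk σ ∈ sectionsToLim f P ⁻¹' {γ.toLim} ↔
        ∀ i, Joined ((SequentialPath.ofSection σ : SequentialPath f P).pt i) (γ.pt i) :=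
      SequentialPath.toLim_eq_iff
    rw [hσ]
    constructor
    · rintro ⟨x, hx⟩ i
      obtain ⟨H⟩ := ZerothHomotopy.mk_eq_mk_iff.1 hx
      exact ⟨(H.map (evalAt f (P.mem_Icc i)).continuous).symm.trans (Q (o x) i).symm⟩
    · intro h
      have q : ∀ i, Path (γ.pt i) ((SequentialPath.ofSection σ : SequentialPath f P).pt i) :=
        fun i => (h i).somePath.symm
      refine ⟨o.symm (GluingOrbits.mk γ.piOne (γ.difference (SequentialPath.ofSection σ) q)), ?_⟩
      exact (hι σ q _).2 (o.apply_symm_apply _)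

end Classification

/-! ### From local to global lifts -/

section Patching

variable {X : Type u} [TopologicalSpace X] {f : X → ℝ} {T : ℝ}

/-- From the points of `O` one can move upwards by a uniform height, up to the level `T`.  The
motion may leave `O`.  Motions of `f` downwards to the level `T` are encoded as motions of `-f`
upwards to `-T`. -/
def HasUpLiftOn (f : X → ℝ) (T : ℝ) (O : Set X) : Prop :=
  ∃ δ > 0, ∃ φ : X → ℝ → X,
    ContinuousOn (Function.uncurry φ)
      {z | z.1 ∈ O ∧ f z.1 ≤ z.2 ∧ z.2 ≤ f z.1 + δ ∧ z.2 ≤ T} ∧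
    (∀ x ∈ O, ∀ t, f x ≤ t → t ≤ f x + δ → t ≤ T → f (φ x t) = t) ∧
    ∀ x ∈ O, φ x (f x) = x

theorem HasUpLiftOn.mono {O O' : Set X} (h : HasUpLiftOn f T O) (hO : O' ⊆ O) :
    HasUpLiftOn f T O' := by
  obtain ⟨δ, hδ, φ, hc, h1, h2⟩ := h
  exact ⟨δ, hδ, φ, hc.mono fun z hz => ⟨hO hz.1, hz.2⟩, fun x hx => h1 x (hO hx),
    fun x hx => h2 x (hO hx)⟩

/-- Motions from two open sets can be combined: move first in the first set, for a part of the
height given by a bump function, and then in the second. -/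
theorem HasUpLiftOn.exists_union [T2Space X] [CompactSpace X] (hf : Continuous f)
    {O₁ O₂ K₁ K₂ : Set X} (hO₁ : IsOpen O₁) (hO₂ : IsOpen O₂) (hK₁ : IsClosed K₁)
    (hK₂ : IsClosed K₂) (hKO₁ : K₁ ⊆ O₁) (hKO₂ : K₂ ⊆ O₂) (h₁ : HasUpLiftOn f T O₁)
    (h₂ : HasUpLiftOn f T O₂) : ∃ O, IsOpen O ∧ K₁ ∪ K₂ ⊆ O ∧ HasUpLiftOn f T O := by
  classical
  obtain ⟨δ₁, hδ₁, φ₁, hc₁, h₁, h₁'⟩ := h₁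
  obtain ⟨δ₂, hδ₂, φ₂, hc₂, h₂, h₂'⟩ := h₂
  obtain ⟨V, hV, hKV, hVO⟩ := normal_exists_closure_subset hK₁ hO₁ hKO₁
  obtain ⟨V', hV', hVV', hVO'⟩ := normal_exists_closure_subset isClosed_closure hO₁ hVO
  obtain ⟨V₂, hV₂, hKV₂, hVO₂⟩ := normal_exists_closure_subset hK₂ hO₂ hKO₂
  obtain ⟨ρ, hρ0, hρ1, hρ⟩ := exists_continuous_zero_one_of_isClosed hV'.isClosed_compl
    isClosed_closure (disjoint_compl_left_iff_subset.2 hVV')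
  let τ : X → ℝ → ℝ := fun x t => f x + ρ x * (t - f x)
  have hτ1 : ∀ x t, f x ≤ t → f x ≤ τ x t := fun x t ht => by
    have := mul_nonneg (hρ x).1 (sub_nonneg.2 ht)
    dsimp only [τ]
    linarith
  have hτ2 : ∀ x t, f x ≤ t → τ x t ≤ t := fun x t ht => by
    have := mul_le_of_le_one_left (sub_nonneg.2 ht) (hρ x).2
    dsimp only [τ]
    linarith
  have hτ0 : ∀ x t, x ∉ V' → τ x t = f x := fun x t hx => by
    simp [τ, hρ0 hx]
  have hτV : ∀ x t, x ∈ V → τ x t = t := fun x t hx => by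
    simp [τ, hρ1 (subset_closure hx)]
  have hτc : Continuous fun z : X × ℝ => τ z.1 z.2 := by
    dsimp only [τ]
    fun_prop
  -- the motion in the first set
  let ψ : X → ℝ → X := fun x t => if x ∈ V' then φ₁ x (τ x t) else x
  let S : Set (X × ℝ) := {z | f z.1 ≤ z.2 ∧ z.2 ≤ f z.1 + δ₁ ∧ z.2 ≤ T}
  have hψO : ∀ x t, x ∈ O₁ → ψ x t = φ₁ x (τ x t) := fun x t hx => by
    dsimp only [ψ]
    split_ifs with h
    · rfl
    · rw [hτ0 x t h, h₁' x hx]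
  have hψS : ∀ x t, f x ≤ t → t ≤ f x + δ₁ → t ≤ T → f (ψ x t) = τ x t := fun x t ha hb hc => by
    dsimp only [ψ]
    split_ifs with h
    · exact h₁ x (hVO' (subset_closure h)) _ (hτ1 x t ha) ((hτ2 x t ha).trans hb)
        ((hτ2 x t ha).trans hc)
    · exact (hτ0 x t h).symm
  have hψf : ∀ x, ψ x (f x) = x := fun x => by
    dsimp only [ψ]
    split_ifs with h
    · simp [τ, h₁' x (hVO' (subset_closure h))]
    · rfl
  have hψc : ContinuousOn (Function.uncurry ψ) S := by
    refine continuousOn_of_locally_continuousOn fun z hz => ?_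
    by_cases hzO : z.1 ∈ O₁
    · refine ⟨Prod.fst ⁻¹' O₁, hO₁.preimage continuous_fst, hzO, ?_⟩
      have : ContinuousOn (fun z : X × ℝ => φ₁ z.1 (τ z.1 z.2)) (S ∩ Prod.fst ⁻¹' O₁) :=
        hc₁.comp (f := fun z : X × ℝ => (z.1, τ z.1 z.2))
          (continuous_fst.prodMk hτc).continuousOn fun w hw =>
          ⟨hw.2, hτ1 _ _ hw.1.1, (hτ2 _ _ hw.1.1).trans hw.1.2.1,
            (hτ2 _ _ hw.1.1).trans hw.1.2.2⟩
      exact this.congr fun w hw => hψO _ _ hw.2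
    · refine ⟨Prod.fst ⁻¹' (closure V')ᶜ, isClosed_closure.isOpen_compl.preimage continuous_fst,
        fun h => hzO (hVO' h), continuous_fst.continuousOn.congr fun w hw => ?_⟩
      exact if_neg fun h => hw.2 (subset_closure h)
  -- for a small time it stays in the second set
  obtain ⟨ε, hε, hεO⟩ : ∃ ε > 0, ∀ x ∈ closure V₂, ∀ t, f x ≤ t → t ≤ f x + δ₁ → t ≤ T →
      t ≤ f x + ε → ψ x t ∈ O₂ := by
    let C : Set (X × ℝ) := {z | z.1 ∈ closure V₂ ∧ z.2 ∈ Icc 0 δ₁ ∧ f z.1 + z.2 ≤ T}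
    have hCc : IsClosed C := (isClosed_closure.preimage continuous_fst).inter
      ((isClosed_Icc.preimage continuous_snd).inter (isClosed_le
        ((hf.comp continuous_fst).add continuous_snd) continuous_const))
    have hC : IsCompact C :=
      (isCompact_univ.prod (isCompact_Icc (a := 0) (b := δ₁))).of_isClosed_subset hCc
        fun z hz => ⟨mem_univ _, hz.2.1⟩
    let g : X × ℝ → X := fun z => ψ z.1 (f z.1 + z.2)
    have hg : ContinuousOn g C :=
      hψc.comp (f := fun z : X × ℝ => (z.1, f z.1 + z.2)) (by fun_prop) fun z hz =>
        ⟨by simpa using hz.2.1.1, by simpa using hz.2.1.2, hz.2.2⟩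
    have hB : IsCompact (C ∩ g ⁻¹' O₂ᶜ) := hC.of_isClosed_subset
      (hg.preimage_isClosed_of_isClosed hCc hO₂.isClosed_compl) inter_subset_left
    rcases (C ∩ g ⁻¹' O₂ᶜ).eq_empty_or_nonempty with hne | hne
    · refine ⟨1, one_pos, fun x hx t ha hb hc _ => ?_⟩
      by_contra hxt
      have : (x, t - f x) ∈ C ∩ g ⁻¹' O₂ᶜ :=
        ⟨⟨hx, ⟨by simpa using ha, sub_le_iff_le_add'.2 hb⟩, by simpa using hc⟩,
          by simpa [g] using hxt⟩
      rw [hne] at this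
      exact this
    · obtain ⟨z, hz, hmin⟩ := hB.exists_isMinOn hne continuous_snd.continuousOn
      have hz2 : 0 < z.2 := by
        refine lt_of_le_of_ne hz.1.2.1.1 fun h => hz.2 ?_
        have : g z = z.1 := by
          dsimp only [g]
          rw [← h, add_zero, hψf]
        rw [this]
        exact hVO₂ hz.1.1
      refine ⟨z.2 / 2, half_pos hz2, fun x hx t ha hb hc ht => ?_⟩
      by_contra hxt
      have : (x, t - f x) ∈ C ∩ g ⁻¹' O₂ᶜ :=
        ⟨⟨hx, ⟨by simpa using ha, sub_le_iff_le_add'.2 hb⟩, by simpa using hc⟩,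
          by simpa [g] using hxt⟩
      have := isMinOn_iff.1 hmin _ this
      dsimp only at this
      linarith
  let χ : X → ℝ → X := fun x t => if x ∈ V then ψ x t else φ₂ (ψ x t) t
  have hm1 : min ε (min δ₁ δ₂) ≤ ε := min_le_left _ _
  have hm2 : min ε (min δ₁ δ₂) ≤ δ₁ := (min_le_right _ _).trans (min_le_left _ _)
  have hm3 : min ε (min δ₁ δ₂) ≤ δ₂ := (min_le_right _ _).trans (min_le_right _ _)
  have hχV₂ : ∀ x t, x ∈ V₂ → f x ≤ t → t ≤ f x + min ε (min δ₁ δ₂) → t ≤ T →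
      χ x t = φ₂ (ψ x t) t := fun x t hx ha hb hc => by
    dsimp only [χ]
    split_ifs with h
    · have h3 := hψS x t ha (by linarith) hc
      rw [hτV x t h] at h3
      have h4 := h₂' _ (hεO x (subset_closure hx) t ha (by linarith) hc (by linarith))
      rw [h3] at h4
      exact h4.symm
    · rfl
  have hmaps : ∀ x t, x ∈ V₂ → f x ≤ t → t ≤ f x + min ε (min δ₁ δ₂) → t ≤ T →
      ψ x t ∈ O₂ ∧ f (ψ x t) ≤ t ∧ t ≤ f (ψ x t) + δ₂ ∧ t ≤ T := fun x t hx ha hb hc => by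
    have h3 := hψS x t ha (by linarith) hc
    refine ⟨hεO x (subset_closure hx) t ha (by linarith) hc (by linarith), ?_, ?_, hc⟩
    · rw [h3]
      exact hτ2 x t ha
    · rw [h3]
      have := hτ1 x t ha
      linarith
  refine ⟨V ∪ V₂, hV.union hV₂, union_subset_union hKV hKV₂, min ε (min δ₁ δ₂),
    lt_min hε (lt_min hδ₁ hδ₂), χ, ?_, ?_, ?_⟩
  · refine continuousOn_of_locally_continuousOn fun z hz => ?_
    rcases hz.1 with hzV | hzV
    · refine ⟨Prod.fst ⁻¹' V, hV.preimage continuous_fst, hzV, ?_⟩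
      refine (hψc.mono ?_).congr fun w hw => if_pos hw.2
      rintro w ⟨⟨-, ha, hb, hc⟩, -⟩
      exact ⟨ha, by linarith, hc⟩
    · refine ⟨Prod.fst ⁻¹' V₂, hV₂.preimage continuous_fst, hzV, ?_⟩
      have : ContinuousOn (fun z : X × ℝ => φ₂ (ψ z.1 z.2) z.2)
          ({z | z.1 ∈ V ∪ V₂ ∧ f z.1 ≤ z.2 ∧ z.2 ≤ f z.1 + min ε (min δ₁ δ₂) ∧ z.2 ≤ T} ∩
            Prod.fst ⁻¹' V₂) := by
        refine hc₂.comp (f := fun z : X × ℝ => (ψ z.1 z.2, z.2))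
          (ContinuousOn.prodMk (hψc.mono ?_) continuousOn_snd) ?_
        · rintro w ⟨⟨-, ha, hb, hc⟩, -⟩
          exact ⟨ha, by linarith, hc⟩
        · rintro w ⟨⟨-, ha, hb, hc⟩, hw⟩
          exact hmaps _ _ hw ha hb hc
      refine this.congr ?_
      rintro w ⟨⟨-, ha, hb, hc⟩, hw⟩
      exact hχV₂ _ _ hw ha hb hc
  · rintro x (hx | hx) t ha hb hc
    · have h3 := hψS x t ha (by linarith) hc
      rw [hτV x t hx] at h3
      dsimp only [χ]
      rwa [if_pos hx]
    · rw [hχV₂ x t hx ha hb hc]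
      obtain ⟨h3, h4, h5, h6⟩ := hmaps x t hx ha hb hc
      exact h₂ _ h3 t h4 h5 h6
  · rintro x hx
    dsimp only [χ]
    rw [hψf]
    split_ifs with h
    · rfl
    · exact h₂' x (hVO₂ (subset_closure (hx.resolve_left h)))

/-- If one can move upwards near each point of a closed set, then one can move upwards near the
set. -/
theorem exists_hasUpLiftOn [T2Space X] [CompactSpace X] (hf : Continuous f) {K : Set X}
    (hK : IsClosed K) (h : ∀ p ∈ K, ∃ U ∈ 𝓝 p, HasUpLiftOn f T U) :
    ∃ O, IsOpen O ∧ K ⊆ O ∧ HasUpLiftOn f T O := by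
  obtain ⟨O, hO, hKO, hL⟩ := hK.isCompact.induction_on
    (p := fun s => ∃ O, IsOpen O ∧ closure s ⊆ O ∧ HasUpLiftOn f T O)
    ⟨∅, isOpen_empty, by simp, 1, one_pos, fun x _ => x, by simp, by simp, by simp⟩
    (fun s t hst ⟨O, hO, htO, hL⟩ => ⟨O, hO, (closure_mono hst).trans htO, hL⟩)
    (fun s t ⟨O, hO, hsO, hL⟩ ⟨O', hO', htO', hL'⟩ => by
      rw [closure_union]
      exact hL.exists_union hf hO hO' isClosed_closure isClosed_closure hsO htO' hL')
    (fun p hp => by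
      obtain ⟨U, hU, hL⟩ := h p hp
      obtain ⟨V, hV, hVc, hVU⟩ := exists_mem_nhds_isClosed_subset (interior_mem_nhds.2 hU)
      exact ⟨V, mem_nhdsWithin_of_mem_nhds hV, interior U, isOpen_interior,
        (hVc.closure_subset).trans hVU, hL.mono interior_subset⟩)
  exact ⟨O, hO, subset_closure.trans hKO, hL⟩

/-- Motions of uniform height can be iterated. -/
theorem HasUpLiftOn.hasLift {O : Set X} (hf : Continuous f) (h : HasUpLiftOn f T O) {a b : ℝ}
    (hab : a ≤ b) (hbT : b ≤ T) (hO : f ⁻¹' Icc a b ⊆ O) : HasLift f (upMoves a b) := by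
  obtain ⟨δ, hδ, φ, hc, h1, h2⟩ := h
  have step : ∀ c c', a ≤ c → c' ≤ b → c' ≤ c + δ → HasLift f (upMoves c c') := by
    intro c c' hac hcb hcc
    have hmaps : ∀ x t, (f x, t) ∈ upMoves c c' →
        x ∈ O ∧ f x ≤ t ∧ t ≤ f x + δ ∧ t ≤ T := by
      rintro x t ⟨h3, h4, h5⟩
      dsimp only at h3 h4 h5
      exact ⟨hO ⟨hac.trans h3, h4.trans (h5.trans hcb)⟩, h4, by linarith, by linarith⟩
    refine ⟨φ, hc.mono fun z hz => hmaps _ _ hz, fun x t ht => ?_, fun x hx => ?_⟩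
    · obtain ⟨h3, h4, h5, h6⟩ := hmaps x t ht
      exact h1 x h3 t h4 h5 h6
    · exact h2 x (hmaps x _ hx).1
  have key : ∀ (N : ℕ) (c : ℝ), a ≤ c → c ≤ b → c ≤ a + N * δ → HasLift f (upMoves a c) := by
    intro N
    induction N with
    | zero =>
      intro c hac hcb hc
      exact step a c le_rfl hcb (by simp at hc; linarith)
    | succ N ih =>
      intro c hac hcb hc
      push_cast at hc
      rcases le_total c (a + δ) with h | h
      · exact step a c le_rfl hcb h
      · exact (ih (c - δ) (by linarith) (by linarith) (by linarith)).upMoves_trans hf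
          (step (c - δ) c (by linarith) hcb (by linarith))
  obtain ⟨N, hN⟩ := exists_nat_ge ((b - a) / δ)
  rw [div_le_iff₀ hδ] at hN
  exact key N b hab le_rfl (by linarith)

theorem hasLift_upMoves [T2Space X] [CompactSpace X] (hf : Continuous f) {a b : ℝ} (hab : a ≤ b)
    (hbT : b ≤ T) (h : ∀ p, f p ∈ Icc a b → ∃ U ∈ 𝓝 p, HasUpLiftOn f T U) :
    HasLift f (upMoves a b) := by
  obtain ⟨O, -, hO, hL⟩ := exists_hasUpLiftOn hf (isClosed_Icc.preimage hf) h
  exact hL.hasLift hf hab hbT hO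

theorem HasUpLiftOn.hasLift_downMoves {O : Set X} (hf : Continuous f)
    (h : HasUpLiftOn (fun x => -f x) (-T) O) {a b : ℝ}
    (hab : a ≤ b) (hT : T ≤ a) (hO : f ⁻¹' Icc a b ⊆ O) : HasLift f (downMoves a b) := by
  have hL := (h.hasLift hf.neg (neg_le_neg hab) (neg_le_neg hT) fun x hx => hO
    ⟨neg_le_neg_iff.1 hx.2, neg_le_neg_iff.1 hx.1⟩).neg
  have hff : (fun x => - -f x) = f := funext fun x => neg_neg _
  refine (hff ▸ hL).mono ?_
  rintro ⟨u, t⟩ ⟨h1, h2, h3⟩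
  exact ⟨neg_le_neg h3, neg_le_neg h2, neg_le_neg h1⟩

/-- If one can move downwards near each point over `[b, c]`, then also near the points just below,
as the space is compact. -/
theorem hasLift_downMoves [T2Space X] [CompactSpace X] (hf : Continuous f) {b c : ℝ}
    (hTb : T ≤ b) (hbc : b ≤ c)
    (h : ∀ p, f p ∈ Icc b c → ∃ U ∈ 𝓝 p, HasUpLiftOn (fun x => -f x) (-T) U) :
    HasLift f (downMoves b c) ∧ IsFlexible f T b := by
  obtain ⟨O, hOo, hO, hL⟩ := exists_hasUpLiftOn hf.neg (isClosed_Icc.preimage hf) h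
  refine ⟨hL.hasLift_downMoves hf hbc hTb hO, ?_⟩
  rcases hTb.eq_or_lt with rfl | hTb
  · exact isFlexible_self f T
  have hb : ∀ x, f x = b → x ∈ O := fun x hx => hO ⟨hx.ge, hx.trans_le hbc⟩
  obtain ⟨η, hη, hηO⟩ : ∃ η > 0, ∀ x, b - η ≤ f x → f x ≤ b → x ∈ O := by
    rcases Oᶜ.eq_empty_or_nonempty with hne | hne
    · exact ⟨1, one_pos, fun x _ _ => by simpa using (compl_empty_iff.1 hne).ge (mem_univ x)⟩
    · obtain ⟨z, hz, hmin⟩ := hOo.isClosed_compl.isCompact.exists_isMinOn hne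
        (f := fun x => |f x - b|) (by fun_prop)
      have hz0 : 0 < |f z - b| := abs_pos.2 fun h => hz (hb z (sub_eq_zero.1 h))
      refine ⟨|f z - b| / 2, half_pos hz0, fun x h1 h2 => ?_⟩
      by_contra hx
      have : |f z - b| ≤ |f x - b| := isMinOn_iff.1 hmin x hx
      rw [abs_of_nonpos (by linarith : f x - b ≤ 0)] at this
      linarith
  have hlt : max T (b - η) < b := max_lt hTb (by linarith)
  refine isFlexible_of_hasLift hf hlt (hL.hasLift_downMoves hf hlt.le (le_max_left _ _) ?_) T
  exact fun x hx => hηO x ((le_max_right _ _).trans hx.1) hx.2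

end Patching

/-! ### Lifting along lines in a chart -/

section Line

variable {E : Type*} [NormedAddCommGroup E] [NormedSpace ℝ E]

theorem mul_sub_le_sub_along_line {S : Set E} {g : E → ℝ} {g' : E → E →L[ℝ] ℝ}
    (hg : ∀ y ∈ S, HasFDerivWithinAt g (g' y) S y) {y v : E} {κ r : ℝ}
    (h : ∀ s ∈ Icc 0 r, y + s • v ∈ S ∧ κ ≤ g' (y + s • v) v) {s t : ℝ} (hs : s ∈ Icc 0 r)
    (ht : t ∈ Icc 0 r) (hst : s ≤ t) :
    κ * (t - s) ≤ g (y + t • v) - g (y + s • v) := by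
  have hd : ∀ s ∈ Icc 0 r,
      HasDerivWithinAt (fun s : ℝ => g (y + s • v)) (g' (y + s • v) v) (Icc 0 r) s := by
    intro s hs
    have hline : HasDerivWithinAt (fun s : ℝ => y + s • v) v (Icc 0 r) s := by
      simpa using (((hasDerivAt_id s).smul_const v).const_add y).hasDerivWithinAt
    exact (hg _ (h s hs).1).comp_hasDerivWithinAt s hline fun w hw => (h w hw).1
  refine (convex_Icc 0 r).mul_sub_le_image_sub_of_le_deriv
    (fun s hs => (hd s hs).continuousWithinAt)
    (fun s hs => ((hd s (interior_subset hs)).differentiableWithinAt).mono interior_subset)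
    (fun s hs => ?_) s hs t ht hst
  rw [((hd s (interior_subset hs)).hasDerivAt (mem_interior_iff_mem_nhds.1 hs)).deriv]
  exact (h s (interior_subset hs)).2

variable {X : Type u} [TopologicalSpace X]

/-- If the function increases at a uniform rate along the segments `e x + [0, m x] v` of a chart
`e`, then one can move upwards along these segments. -/
theorem hasUpLiftOn_of_line (e : PartialEquiv X E) {h m : X → ℝ} {T κ δ : ℝ} {U : Set X} {v : E}
    (hU : U ⊆ e.source) (he : ContinuousOn e U) (hes : ContinuousOn e.symm e.target)
    {g' : E → E →L[ℝ] ℝ}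
    (hg : ∀ y ∈ e.target, HasFDerivWithinAt (h ∘ e.symm) (g' y) e.target y)
    (hm : ContinuousOn m U) (hm0 : ∀ x ∈ U, 0 ≤ m x) (hκ : 0 < κ) (hδ : 0 < δ)
    (hline : ∀ x ∈ U, ∀ s ∈ Icc 0 (m x), e x + s • v ∈ e.target ∧ κ ≤ g' (e x + s • v) v)
    (hend : ∀ x ∈ U, ∀ t, t ≤ h x + δ → t ≤ T → t ≤ h (e.symm (e x + m x • v))) :
    HasUpLiftOn h T U := by
  classical
  have hmono : ∀ x ∈ U, ∀ s ∈ Icc 0 (m x), ∀ t ∈ Icc 0 (m x), s ≤ t →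
      κ * (t - s) ≤ h (e.symm (e x + t • v)) - h (e.symm (e x + s • v)) :=
    fun x hx s hs t ht hst => mul_sub_le_sub_along_line hg (hline x hx) hs ht hst
  have habs : ∀ x ∈ U, ∀ s ∈ Icc 0 (m x), ∀ t ∈ Icc 0 (m x),
      κ * |t - s| ≤ |h (e.symm (e x + t • v)) - h (e.symm (e x + s • v))| := by
    intro x hx s hs t ht
    rcases le_total s t with hst | hst
    · rw [abs_of_nonneg (sub_nonneg.2 hst)]
      exact (hmono x hx s hs t ht hst).trans (le_abs_self _)
    · rw [abs_sub_comm, abs_of_nonneg (sub_nonneg.2 hst), abs_sub_comm (h _)]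
      exact (hmono x hx t ht s hs hst).trans (le_abs_self _)
  have hgc : ContinuousOn (h ∘ e.symm) e.target := fun y hy => (hg y hy).continuousWithinAt
  have h0 : ∀ x ∈ U, h (e.symm (e x + (0 : ℝ) • v)) = h x := fun x hx => by
    rw [zero_smul, add_zero, e.left_inv (hU hx)]
  let A : Set (X × ℝ) := {z | z.1 ∈ U ∧ h z.1 ≤ z.2 ∧ z.2 ≤ h z.1 + δ ∧ z.2 ≤ T}
  have hex : ∀ z : X × ℝ, ∃ s : ℝ, (z ∈ A →
      s ∈ Icc 0 (m z.1) ∧ h (e.symm (e z.1 + s • v)) = z.2) ∧ (z ∉ A → s = 0) := by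
    rintro ⟨x, t⟩
    by_cases hz : (x, t) ∈ A
    · obtain ⟨hx, h1, h2, h3⟩ := id hz
      have hcont : ContinuousOn (fun s : ℝ => h (e.symm (e x + s • v))) (Icc 0 (m x)) :=
        hgc.comp (f := fun s : ℝ => e x + s • v) (by fun_prop) fun s hs => (hline x hx s hs).1
      have hmem : t ∈ Icc (h (e.symm (e x + (0 : ℝ) • v))) (h (e.symm (e x + m x • v))) :=
        ⟨(h0 x hx).trans_le h1, hend x hx t h2 h3⟩
      obtain ⟨s, hs, hst⟩ := intermediate_value_Icc (hm0 x hx) hcont hmem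
      exact ⟨s, fun _ => ⟨hs, hst⟩, fun hz0 => absurd hz hz0⟩
    · exact ⟨0, fun h => absurd h hz, fun _ => rfl⟩
  choose s hs hs0 using hex
  have hsc : ContinuousOn s A := by
    intro z hz
    -- compare `s w` with `s z`, cut off at the end of the segment of `w`
    have hfst : ContinuousOn (Prod.fst : X × ℝ → X) A := continuousOn_fst
    have hmA : ContinuousOn (fun w : X × ℝ => min (s z) (m w.1)) A :=
      continuousOn_const.inf (hm.comp hfst fun w hw => hw.1)
    have hcut : ∀ w ∈ A, min (s z) (m w.1) ∈ Icc 0 (m w.1) := fun w hw =>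
      ⟨le_min (hs z hz).1.1 (hm0 _ hw.1), min_le_right _ _⟩
    have hcA : ContinuousOn
        (fun w : X × ℝ => h (e.symm (e w.1 + min (s z) (m w.1) • v))) A :=
      hgc.comp (f := fun w : X × ℝ => e w.1 + min (s z) (m w.1) • v)
        ((he.comp hfst fun w hw => hw.1).add (hmA.smul continuousOn_const))
        fun w hw => (hline _ hw.1 _ (hcut w hw)).1
    have hzz : min (s z) (m z.1) = s z := min_eq_left (hs z hz).1.2
    have hlim : Tendsto (fun w : X × ℝ =>
        |w.2 - h (e.symm (e w.1 + min (s z) (m w.1) • v))| / κ + |min (s z) (m w.1) - s z|)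
        (𝓝[A] z) (𝓝 0) := by
      have := ((((continuousOn_snd.sub hcA).abs).div_const κ).add
        ((hmA.sub (continuousOn_const (c := s z))).abs)) z hz
      have hval : |z.2 - h (e.symm (e z.1 + min (s z) (m z.1) • v))| / κ
          + |min (s z) (m z.1) - s z| = 0 := by
        rw [hzz, (hs z hz).2]
        simp
      rw [← hval]
      exact this
    rw [ContinuousWithinAt, tendsto_iff_dist_tendsto_zero]
    refine squeeze_zero' (Eventually.of_forall fun w => dist_nonneg) ?_ hlim
    filter_upwards [self_mem_nhdsWithin] with w hw
    have h1 := habs _ hw.1 _ (hcut w hw) _ (hs w hw).1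
    rw [(hs w hw).2] at h1
    rw [Real.dist_eq]
    refine (abs_sub_le _ (min (s z) (m w.1)) _).trans (add_le_add_left ?_ _)
    rwa [le_div_iff₀' hκ]
  refine ⟨δ, hδ, fun x t => e.symm (e x + s (x, t) • v), ?_, ?_, ?_⟩
  · refine hes.comp (f := fun z : X × ℝ => e z.1 + s (z.1, z.2) • v)
      ((he.comp continuousOn_fst fun w hw => hw.1).add (hsc.smul continuousOn_const)) ?_
    exact fun w hw => (hline _ hw.1 _ (hs w hw).1).1
  · exact fun x hx t h1 h2 h3 => (hs (x, t) ⟨hx, h1, h2, h3⟩).2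
  · intro x hx
    have h3 : s (x, h x) = 0 := by
      by_cases hA : (x, h x) ∈ A
      · have h1 := hs _ hA
        have h2 := habs x hx 0 ⟨le_rfl, hm0 x hx⟩ _ h1.1
        rw [h0 x hx, h1.2, sub_self, abs_zero, sub_zero] at h2
        have := abs_nonneg (s (x, h x))
        exact abs_eq_zero.1 (le_antisymm (by nlinarith) this)
      · exact hs0 _ hA
    simp only [h3, zero_smul, add_zero]
    exact e.left_inv (hU hx)

end Line

/-! ### Local lifts on a manifold with corners -/

section Quadrant

variable {d : ℕ} {X : Type u} [TopologicalSpace X] [ChartedSpace (EuclideanQuadrant d) X]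

/-- The derivative at `p` of `h`, read in the preferred chart at `p`. -/
noncomputable def chartDeriv (d : ℕ) {X : Type u} [TopologicalSpace X]
    [ChartedSpace (EuclideanQuadrant d) X] (h : X → ℝ) (p : X) :
    EuclideanSpace ℝ (Fin d) →L[ℝ] ℝ :=
  fderivWithin ℝ (h ∘ (extChartAt (modelWithCornersEuclideanQuadrant d) p).symm)
    (extChartAt (modelWithCornersEuclideanQuadrant d) p).target
    (extChartAt (modelWithCornersEuclideanQuadrant d) p p)

theorem range_modelWithCornersEuclideanQuadrant :
    range (modelWithCornersEuclideanQuadrant d) = {y | ∀ i, 0 ≤ y i} :=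
  range_euclideanQuadrant d

theorem chartCoord_nonneg {p q : X}
    (i : Fin d) : 0 ≤ chartCoord d p i q := by
  have h : extChartAt (modelWithCornersEuclideanQuadrant d) p q ∈
      range (modelWithCornersEuclideanQuadrant d) := mem_range_self _
  rw [range_modelWithCornersEuclideanQuadrant] at h
  exact h i

theorem continuousAt_chartCoord (p : X) (i : Fin d) : ContinuousAt (chartCoord d p i) p :=
  (EuclideanSpace.proj (𝕜 := ℝ) i).continuous.continuousAt.comp (continuousAt_extChartAt p)

theorem chartDeriv_neg (h : X → ℝ) (p : X) :
    chartDeriv d (fun x => -h x) p = -chartDeriv d h p :=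
  fderivWithin_fun_neg (uniqueDiffOn_extChartAt_target p _ (mem_extChartAt_target p))

theorem mfderiv_eq_chartDeriv {h : X → ℝ}
    (hh : ContMDiff (modelWithCornersEuclideanQuadrant d) 𝓘(ℝ, ℝ) ∞ h) (p : X)
    (v : EuclideanSpace ℝ (Fin d)) :
    mfderiv (modelWithCornersEuclideanQuadrant d) 𝓘(ℝ, ℝ) h p v = chartDeriv d h p v := by
  have hd : MDifferentiableAt (modelWithCornersEuclideanQuadrant d) 𝓘(ℝ, ℝ) h p :=
    hh.mdifferentiable (by simp) p
  have h1 := hd.mfderiv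
  have h2 : chartDeriv d h p = fderivWithin ℝ
      (h ∘ (extChartAt (modelWithCornersEuclideanQuadrant d) p).symm)
      (range (modelWithCornersEuclideanQuadrant d))
      (extChartAt (modelWithCornersEuclideanQuadrant d) p p) :=
    fderivWithin_subset (extChartAt_target_subset_range p)
      (uniqueDiffOn_extChartAt_target p _ (mem_extChartAt_target p))
      hd.differentiableWithinAt_writtenInExtChartAt
  rw [h2, h1]
  rfl

/-- Near `p` and for a short time, the line in direction `v` stays in a given neighbourhood of `p`
in the quadrant, as long as it stays in the quadrant. -/
theorem exists_line_mem (p : X) {S : Set (EuclideanSpace ℝ (Fin d))}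
    (hS : S ∈ 𝓝[range (modelWithCornersEuclideanQuadrant d)]
      (extChartAt (modelWithCornersEuclideanQuadrant d) p p)) (v : EuclideanSpace ℝ (Fin d)) :
    ∃ U ∈ 𝓝 p, ∃ ε > (0 : ℝ), U ⊆ (extChartAt (modelWithCornersEuclideanQuadrant d) p).source ∧
      ∀ x ∈ U, ∀ s : ℝ, 0 ≤ s → s < ε →
        (∀ i, extChartAt (modelWithCornersEuclideanQuadrant d) p p i ≠ 0 →
          0 ≤ (extChartAt (modelWithCornersEuclideanQuadrant d) p x + s • v) i) ∧
        ((∀ i, 0 ≤ (extChartAt (modelWithCornersEuclideanQuadrant d) p x + s • v) i) →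
          extChartAt (modelWithCornersEuclideanQuadrant d) p x + s • v ∈ S) := by
  set e := extChartAt (modelWithCornersEuclideanQuadrant d) p with he
  have hcont : Tendsto (fun z : X × ℝ => e z.1 + z.2 • v) (𝓝 p ×ˢ 𝓝 0) (𝓝 (e p)) := by
    have h1 : Tendsto (fun z : X × ℝ => e z.1) (𝓝 p ×ˢ 𝓝 0) (𝓝 (e p)) :=
      (continuousAt_extChartAt p).tendsto.comp tendsto_fst
    have h2 : Tendsto (fun z : X × ℝ => z.2 • v) (𝓝 p ×ˢ 𝓝 0) (𝓝 ((0 : ℝ) • v)) :=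
      tendsto_snd.smul_const v
    simpa using h1.add h2
  have hpos : ∀ᶠ y in 𝓝 (e p), ∀ i, e p i ≠ 0 → 0 ≤ y i := by
    refine eventually_all.2 fun i => ?_
    by_cases hi : e p i = 0
    · exact Eventually.of_forall fun y h => absurd hi h
    · have hpi : 0 < e p i := lt_of_le_of_ne (chartCoord_nonneg (p := p) (q := p) i) (Ne.symm hi)
      have hlim : Tendsto (fun y : EuclideanSpace ℝ (Fin d) => y i) (𝓝 (e p)) (𝓝 (e p i)) :=
        (EuclideanSpace.proj (𝕜 := ℝ) i).continuous.continuousAt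
      filter_upwards [hlim.eventually_const_lt hpi] with y hy _
      exact hy.le
  have hSr : ∀ᶠ y in 𝓝 (e p), (∀ i, 0 ≤ y i) → y ∈ S := by
    rw [range_modelWithCornersEuclideanQuadrant] at hS
    exact mem_nhdsWithin_iff_eventually.1 hS
  obtain ⟨P, hP, Q, hQ, hPQ⟩ := eventually_prod_iff.1 (hcont.eventually (hpos.and hSr))
  obtain ⟨ε, hε, hεQ⟩ := Metric.eventually_nhds_iff.1 hQ
  refine ⟨{x | P x} ∩ e.source, inter_mem hP (extChartAt_source_mem_nhds p), ε, hε,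
    inter_subset_right, fun x hx s hs0 hs => ?_⟩
  exact hPQ hx.1 (hεQ (by rwa [Real.dist_eq, sub_zero, abs_of_nonneg hs0]))

theorem mem_posTangentConeAt_of_nonneg (p : X) {v : EuclideanSpace ℝ (Fin d)} (hv : ∀ j, 0 ≤ v j)
    {F : Set (EuclideanSpace ℝ (Fin d))}
    (hF : ∀ s : ℝ, extChartAt (modelWithCornersEuclideanQuadrant d) p p + s • v ∈ F) :
    v ∈ posTangentConeAt ((extChartAt (modelWithCornersEuclideanQuadrant d) p).target ∩ F)
      (extChartAt (modelWithCornersEuclideanQuadrant d) p p) := by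
  obtain ⟨U, hU, ε, hε, -, hline⟩ := exists_line_mem p
    (extChartAt_target_mem_nhdsWithin (I := modelWithCornersEuclideanQuadrant d) p) v
  refine mem_posTangentConeAt_of_frequently_mem (Eventually.frequently ?_)
  filter_upwards [Ioo_mem_nhdsGT hε] with s hs
  refine ⟨(hline p (mem_of_mem_nhds hU) s hs.1.le hs.2).2 fun i => ?_, hF s⟩
  have h1 : 0 ≤ extChartAt (modelWithCornersEuclideanQuadrant d) p p i := chartCoord_nonneg i
  simpa using add_nonneg h1 (mul_nonneg hs.1.le (hv i))

section Smooth

variable [IsManifold (modelWithCornersEuclideanQuadrant d) ∞ X] {h : X → ℝ}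

theorem contDiffOn_comp_extChartAt_symm
    (hh : ContMDiff (modelWithCornersEuclideanQuadrant d) 𝓘(ℝ, ℝ) ∞ h) (p : X) :
    ContDiffOn ℝ ∞ (h ∘ (extChartAt (modelWithCornersEuclideanQuadrant d) p).symm)
      (extChartAt (modelWithCornersEuclideanQuadrant d) p).target :=
  (hh.comp_contMDiffOn (contMDiffOn_extChartAt_symm p)).contDiffOn

theorem eventually_lt_fderivWithin
    (hh : ContMDiff (modelWithCornersEuclideanQuadrant d) 𝓘(ℝ, ℝ) ∞ h) {p : X}
    {v : EuclideanSpace ℝ (Fin d)} {κ : ℝ} (hκ : κ < chartDeriv d h p v) :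
    ∀ᶠ y in 𝓝[range (modelWithCornersEuclideanQuadrant d)]
        (extChartAt (modelWithCornersEuclideanQuadrant d) p p),
      y ∈ (extChartAt (modelWithCornersEuclideanQuadrant d) p).target ∧
        κ < fderivWithin ℝ (h ∘ (extChartAt (modelWithCornersEuclideanQuadrant d) p).symm)
          (extChartAt (modelWithCornersEuclideanQuadrant d) p).target y v := by
  rw [← nhdsWithin_extChartAt_target_eq]
  have hc := (contDiffOn_comp_extChartAt_symm hh p).continuousOn_fderivWithin
    (uniqueDiffOn_extChartAt_target p) (by simp) _ (mem_extChartAt_target p)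
  have hlim : Tendsto (fun y => fderivWithin ℝ
      (h ∘ (extChartAt (modelWithCornersEuclideanQuadrant d) p).symm)
      (extChartAt (modelWithCornersEuclideanQuadrant d) p).target y v)
      (𝓝[(extChartAt (modelWithCornersEuclideanQuadrant d) p).target]
        (extChartAt (modelWithCornersEuclideanQuadrant d) p p)) (𝓝 (chartDeriv d h p v)) :=
    ((ContinuousLinearMap.apply ℝ ℝ v).continuous.tendsto _).comp hc
  exact eventually_mem_nhdsWithin.and (hlim.eventually_const_lt hκ)

theorem hasFDerivWithinAt_comp_extChartAt_symm
    (hh : ContMDiff (modelWithCornersEuclideanQuadrant d) 𝓘(ℝ, ℝ) ∞ h) (p : X) :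
    ∀ y ∈ (extChartAt (modelWithCornersEuclideanQuadrant d) p).target,
      HasFDerivWithinAt (h ∘ (extChartAt (modelWithCornersEuclideanQuadrant d) p).symm)
        (fderivWithin ℝ (h ∘ (extChartAt (modelWithCornersEuclideanQuadrant d) p).symm)
          (extChartAt (modelWithCornersEuclideanQuadrant d) p).target y)
        (extChartAt (modelWithCornersEuclideanQuadrant d) p).target y := fun y hy =>
  (((contDiffOn_comp_extChartAt_symm hh p).differentiableOn (by simp)) y hy).hasFDerivWithinAt

/-- One can move upwards near `p` along a direction in which the function increases and which does
not point out of the quadrant. -/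
theorem exists_hasUpLiftOn_of_direction
    (hh : ContMDiff (modelWithCornersEuclideanQuadrant d) 𝓘(ℝ, ℝ) ∞ h) {p : X}
    {v : EuclideanSpace ℝ (Fin d)} (hv : ∀ i, chartCoord d p i p = 0 → 0 ≤ v i)
    (hl : 0 < chartDeriv d h p v) (T : ℝ) : ∃ U ∈ 𝓝 p, HasUpLiftOn h T U := by
  obtain ⟨U, hU, ε, hε, hUs, hline⟩ :=
    exists_line_mem p (eventually_lt_fderivWithin hh (half_lt_self hl)) v
  have hκ := half_pos hl
  set κ := chartDeriv d h p v / 2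
  have hmem : ∀ x ∈ U, ∀ s ∈ Icc 0 (ε / 2), _ := fun x hx s hs =>
    (hline x hx s hs.1 (hs.2.trans_lt (half_lt_self hε))).2 fun i => by
      by_cases hi : extChartAt (modelWithCornersEuclideanQuadrant d) p p i = 0
      · have h1 : 0 ≤ extChartAt (modelWithCornersEuclideanQuadrant d) p x i :=
          chartCoord_nonneg i
        have h2 := mul_nonneg hs.1 (hv i hi)
        simpa using add_nonneg h1 h2
      · exact (hline x hx s hs.1 (hs.2.trans_lt (half_lt_self hε))).1 i hi
  have hmem' : ∀ x ∈ U, ∀ s ∈ Icc 0 (ε / 2), _ ∧ _ := fun x hx s hs =>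
    ⟨(hmem x hx s hs).1, (hmem x hx s hs).2.le⟩
  refine ⟨U, hU, hasUpLiftOn_of_line (δ := κ * (ε / 2)) (m := fun _ => ε / 2)
    (extChartAt (modelWithCornersEuclideanQuadrant d) p) hUs
    ((continuousOn_extChartAt p).mono hUs) (continuousOn_extChartAt_symm p)
    (hasFDerivWithinAt_comp_extChartAt_symm hh p) continuousOn_const (fun _ _ => (half_pos hε).le)
    hκ (mul_pos hκ (half_pos hε)) hmem' fun x hx t ht _ => ?_⟩
  have h1 := mul_sub_le_sub_along_line (hasFDerivWithinAt_comp_extChartAt_symm hh p) (hmem' x hx)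
    (left_mem_Icc.2 (half_pos hε).le) (right_mem_Icc.2 (half_pos hε).le) (half_pos hε).le
  simp only [zero_smul, add_zero, sub_zero, Function.comp_apply,
    (extChartAt (modelWithCornersEuclideanQuadrant d) p).left_inv (hUs hx)] at h1
  linarith

/-- If `h = T` is near `p` a boundary hyperplane, and `h` increases towards it, then one can move
upwards near `p` until one hits the hyperplane. -/
theorem exists_hasUpLiftOn_of_wall
    (hh : ContMDiff (modelWithCornersEuclideanQuadrant d) 𝓘(ℝ, ℝ) ∞ h) {p : X} {i : Fin d} {T : ℝ}
    (hp : h p = T) (hi : IsFaceAt d {q | h q = T} p i)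
    (hl : chartDeriv d h p (EuclideanSpace.single i 1) < 0) :
    ∃ U ∈ 𝓝 p, HasUpLiftOn h T U := by
  have hl' : 0 < chartDeriv d h p (-EuclideanSpace.single i 1) := by simpa using hl
  have hκ := half_pos hl'
  have hface : ∀ᶠ y in 𝓝[range (modelWithCornersEuclideanQuadrant d)]
      (extChartAt (modelWithCornersEuclideanQuadrant d) p p),
      y ∈ (extChartAt (modelWithCornersEuclideanQuadrant d) p).target → y i = 0 →
        h ((extChartAt (modelWithCornersEuclideanQuadrant d) p).symm y) = T := by
    have hlim := (continuousAt_extChartAt_symm (I := modelWithCornersEuclideanQuadrant d) p).tendsto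
    rw [extChartAt_to_inv] at hlim
    filter_upwards [nhdsWithin_le_nhds (hlim.eventually hi)] with y hy hyt hyi
    refine hy.2 ?_
    rw [chartCoord, (extChartAt (modelWithCornersEuclideanQuadrant d) p).right_inv hyt]
    exact hyi
  obtain ⟨U, hU, ε, hε, hUs, hline⟩ := exists_line_mem p
    ((eventually_lt_fderivWithin hh (half_lt_self hl')).and hface) (-EuclideanSpace.single i 1)
  have hp0 : chartCoord d p i p = 0 := hi.self_of_nhds.1 hp
  have hUm : ∀ᶠ x in 𝓝 p, chartCoord d p i x < ε :=
    (continuousAt_chartCoord p i).tendsto.eventually_lt_const (by rwa [hp0])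
  have hmem : ∀ x ∈ U ∩ {x | chartCoord d p i x < ε}, ∀ s ∈ Icc 0 (chartCoord d p i x), _ :=
    fun x hx s hs => (hline x hx.1 s hs.1 (hs.2.trans_lt hx.2)).2 fun j => by
      have h1 : 0 ≤ extChartAt (modelWithCornersEuclideanQuadrant d) p x j := chartCoord_nonneg j
      by_cases hj : j = i
      · subst hj
        have h2 : s ≤ extChartAt (modelWithCornersEuclideanQuadrant d) p x j := hs.2
        simpa using h2
      · simpa [hj] using h1
  refine ⟨_, inter_mem hU hUm, hasUpLiftOn_of_line (δ := 1) (m := chartCoord d p i)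
    (extChartAt (modelWithCornersEuclideanQuadrant d) p) (inter_subset_left.trans hUs)
    ((continuousOn_extChartAt p).mono (inter_subset_left.trans hUs))
    (continuousOn_extChartAt_symm p) (hasFDerivWithinAt_comp_extChartAt_symm hh p)
    ((EuclideanSpace.proj (𝕜 := ℝ) i).continuous.comp_continuousOn
      ((continuousOn_extChartAt p).mono (inter_subset_left.trans hUs)))
    (fun x _ => chartCoord_nonneg i) hκ one_pos
    (fun x hx s hs => ⟨(hmem x hx s hs).1.1, (hmem x hx s hs).1.2.le⟩) fun x hx t _ ht => ?_⟩
  have h1 := hmem x hx _ (right_mem_Icc.2 (chartCoord_nonneg i))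
  refine ht.trans_eq (h1.2 h1.1.1 ?_).symm
  simp [chartCoord]

/-- At a regular point of the minimum, if the minimum is near the point a boundary hyperplane, then
`h` increases in the direction of the inner normal. -/
theorem chartDeriv_single_pos
    (hh : ContMDiff (modelWithCornersEuclideanQuadrant d) 𝓘(ℝ, ℝ) ∞ h) {p : X} {i : Fin d} {c : ℝ}
    (hc : ∀ q, c ≤ h q) (hp : h p = c) (hi : IsFaceAt d {q | h q = c} p i)
    (hl : chartDeriv d h p ≠ 0) :
    0 < chartDeriv d h p (EuclideanSpace.single i 1) := by
  have hd := hasFDerivWithinAt_comp_extChartAt_symm hh p _ (mem_extChartAt_target p)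
  have hval : (h ∘ (extChartAt (modelWithCornersEuclideanQuadrant d) p).symm)
      (extChartAt (modelWithCornersEuclideanQuadrant d) p p) = c := by
    rw [Function.comp_apply, extChartAt_to_inv, hp]
  have hsingle : ∀ j k : Fin d, 0 ≤ (EuclideanSpace.single j (1 : ℝ)) k := fun j k => by
    rw [PiLp.single_apply]
    split_ifs <;> norm_num
  have hnonneg : ∀ j, 0 ≤ chartDeriv d h p (EuclideanSpace.single j 1) := fun j => by
    refine IsLocalMinOn.hasFDerivWithinAt_nonneg (Eventually.of_forall fun y => ?_)
      (hd.mono inter_subset_left)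
      (mem_posTangentConeAt_of_nonneg p (hsingle j) (F := univ) fun _ => mem_univ _)
    rw [hval]
    exact hc _
  have hp0 : extChartAt (modelWithCornersEuclideanQuadrant d) p p i = 0 := hi.self_of_nhds.1 hp
  have hnonpos : ∀ j, j ≠ i → chartDeriv d h p (EuclideanSpace.single j 1) ≤ 0 := fun j hj => by
    refine IsLocalMaxOn.hasFDerivWithinAt_nonpos ?_ (hd.mono inter_subset_left)
      (mem_posTangentConeAt_of_nonneg p (hsingle j) (F := {y | y i = 0}) fun s => ?_)
    · have hlim := (continuousAt_extChartAt_symm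
        (I := modelWithCornersEuclideanQuadrant d) p).tendsto
      rw [extChartAt_to_inv] at hlim
      filter_upwards [nhdsWithin_le_nhds (hlim.eventually hi), self_mem_nhdsWithin] with y hy hyF
      rw [hval]
      refine (hy.2 ?_).le
      rw [chartCoord, (extChartAt (modelWithCornersEuclideanQuadrant d) p).right_inv hyF.1]
      exact hyF.2
    · have h1 : extChartAt (modelWithCornersEuclideanQuadrant d) p p i
          + s * (EuclideanSpace.single j (1 : ℝ)) i = 0 := by
        rw [hp0]
        simp [hj.symm]
      exact h1
  refine (hnonneg i).lt_of_ne fun h0 => hl ?_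
  refine ContinuousLinearMap.coe_injective
    ((EuclideanSpace.basisFun (Fin d) ℝ).toBasis.ext fun j => ?_)
  by_cases hj : j = i
  · subst hj
    simpa using h0.symm
  · simpa using le_antisymm (hnonpos j hj) (hnonneg j)

end Smooth

end Quadrant

/-! ### Tame functions -/

section TameFunctions

variable {d : ℕ} {X : Type u} [TopologicalSpace X] [ChartedSpace (EuclideanQuadrant d) X]
  {Xm Xp : Set X} {sm sp : ℝ} {f : X → ℝ}

theorem IsTame.exists_chartDeriv_pos (hf : IsTame d Xm Xp sm sp f) (p : X) :
    ∃ v, 0 < chartDeriv d f p v := by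
  obtain ⟨v, hv⟩ := hf.submersive p (1 : ℝ)
  have h := mfderiv_eq_chartDeriv hf.contMDiff p v
  exact ⟨v, by rw [← h, hv]; exact one_pos⟩

theorem IsTame.contMDiff_neg (hf : IsTame d Xm Xp sm sp f) :
    ContMDiff (modelWithCornersEuclideanQuadrant d) 𝓘(ℝ, ℝ) ∞ fun x => -f x :=
  contDiff_neg.contMDiff.comp hf.contMDiff

variable [IsManifold (modelWithCornersEuclideanQuadrant d) ∞ X]

theorem isBoundaryPoint_of_chartCoord_eq_zero {p q : X} {i : Fin d}
    (hq : q ∈ (chartAt (EuclideanQuadrant d) p).source) (hi : chartCoord d p i q = 0) :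
    q ∈ (modelWithCornersEuclideanQuadrant d).boundary X := by
  have h1 : ¬ (modelWithCornersEuclideanQuadrant d).IsInteriorPoint q := fun h => by
    rw [ModelWithCorners.isInteriorPoint_iff_of_mem_atlas (n := ∞) (by simp)
      (chart_mem_atlas _ p) hq] at h
    have h2 := OpenPartialHomeomorph.interior_extend_target_subset_interior_range _ h
    rw [range_modelWithCornersEuclideanQuadrant, interior_euclideanQuadrant] at h2
    exact (h2 i).ne' hi
  exact (ModelWithCorners.isBoundaryPoint_iff_not_isInteriorPoint q).2 h1

theorem chartCoord_pos_of_notMem_boundary {p : X}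
    (hp : p ∉ (modelWithCornersEuclideanQuadrant d).boundary X) (i : Fin d) :
    0 < chartCoord d p i p :=
  (chartCoord_nonneg i).lt_of_ne fun h =>
    hp (isBoundaryPoint_of_chartCoord_eq_zero (mem_chart_source _ p) h.symm)

/-- Away from the two ends there are no corners: another boundary hyperplane through a point of the
side would consist of points of the side as well. -/
theorem IsCobordism.eq_of_chartCoord_eq_zero (hX : IsCobordism d Xm Xp) {p : X} (hm : p ∉ Xm)
    (hp : p ∉ Xp) {i k : Fin d} (hi : IsFaceAt d (sideBoundary d Xm Xp) p i)
    (hk : chartCoord d p k p = 0) : k = i := by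
  by_contra hki
  set e := extChartAt (modelWithCornersEuclideanQuadrant d) p with he
  have hside : p ∈ sideBoundary d Xm Xp := subset_closure
    ⟨isBoundaryPoint_of_chartCoord_eq_zero (mem_chart_source _ p) hk, fun h => h.elim hm hp⟩
  have hi0 : chartCoord d p i p = 0 := hi.self_of_nhds.1 hside
  -- move away from the `i`-th hyperplane inside the `k`-th
  obtain ⟨U, hU, ε, hε, -, hline⟩ := exists_line_mem p
    (extChartAt_target_mem_nhdsWithin (I := modelWithCornersEuclideanQuadrant d) p)
    (EuclideanSpace.single i (1 : ℝ))
  have hlim : Tendsto (fun s : ℝ => e.symm (e p + s • EuclideanSpace.single i (1 : ℝ)))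
      (𝓝[>] 0) (𝓝 p) := by
    have h1 : Tendsto (fun s : ℝ => e p + s • EuclideanSpace.single i (1 : ℝ)) (𝓝 0)
        (𝓝 (e p + (0 : ℝ) • EuclideanSpace.single i (1 : ℝ))) :=
      (Continuous.tendsto (by fun_prop) 0)
    rw [zero_smul, add_zero] at h1
    have h2 := (continuousAt_extChartAt_symm (I := modelWithCornersEuclideanQuadrant d) p).tendsto
    rw [extChartAt_to_inv] at h2
    exact (h2.comp h1).mono_left nhdsWithin_le_nhds
  have hsrc : ∀ᶠ q in 𝓝 p, q ∈ (chartAt (EuclideanQuadrant d) p).source :=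
    (chartAt (EuclideanQuadrant d) p).open_source.mem_nhds (mem_chart_source _ p)
  obtain ⟨s, ⟨⟨⟨hqi, hqs⟩, hqm⟩, hqp⟩, hs⟩ :=
    (((((hlim.eventually hi).and (hlim.eventually hsrc)).and
      (hlim.eventually (hX.isClosed_bot.isOpen_compl.mem_nhds hm))).and
      (hlim.eventually (hX.isClosed_top.isOpen_compl.mem_nhds hp))).and
      (Ioo_mem_nhdsGT hε)).exists
  have ht : e p + s • EuclideanSpace.single i (1 : ℝ) ∈ e.target := by
    refine (hline p (mem_of_mem_nhds hU) s hs.1.le hs.2).2 fun j => ?_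
    have h1 : 0 ≤ e p j := chartCoord_nonneg j
    have h2 : 0 ≤ (EuclideanSpace.single i (1 : ℝ)) j := by
      rw [PiLp.single_apply]
      split_ifs <;> norm_num
    exact add_nonneg h1 (mul_nonneg hs.1.le h2)
  have hcoord : ∀ j, chartCoord d p j (e.symm (e p + s • EuclideanSpace.single i (1 : ℝ)))
      = chartCoord d p j p + s * (EuclideanSpace.single i (1 : ℝ)) j := fun j => by
    rw [chartCoord, ← he, e.right_inv ht]
    rfl
  have hqk : chartCoord d p k (e.symm (e p + s • EuclideanSpace.single i (1 : ℝ))) = 0 := by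
    rw [hcoord, hk]
    simp [hki]
  have hq : chartCoord d p i (e.symm (e p + s • EuclideanSpace.single i (1 : ℝ))) = 0 :=
    hqi.1 (subset_closure ⟨isBoundaryPoint_of_chartCoord_eq_zero hqs hqk,
      fun h => h.elim hqm hqp⟩)
  rw [hcoord, hi0] at hq
  simp at hq
  exact hs.1.ne' hq

/-- At the bottom the function increases along the inner normal of the bottom face, and one can move
downwards until one hits this face. -/
theorem IsTame.exists_hasUpLiftOn_of_mem_bot (hf : IsTame d Xm Xp sm sp f) {p : X} (hp : p ∈ Xm) :
    (∃ U ∈ 𝓝 p, HasUpLiftOn f sp U) ∧ ∃ U ∈ 𝓝 p, HasUpLiftOn (fun x => -f x) (-sm) U := by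
  have hbot := hf.bot_eq
  obtain ⟨i, hi⟩ := hf.isCobordism.face_bot p hp
  rw [hbot] at hi hp
  obtain ⟨w, hw⟩ := hf.exists_chartDeriv_pos p
  have hpos := chartDeriv_single_pos hf.contMDiff (fun q => (hf.mem_Icc q).1) hp hi
    (fun h => by simp [h] at hw)
  refine ⟨exists_hasUpLiftOn_of_direction hf.contMDiff (fun j _ => ?_) hpos sp,
    exists_hasUpLiftOn_of_wall hf.contMDiff_neg (congrArg Neg.neg hp) (i := i) ?_ ?_⟩
  · rw [PiLp.single_apply]
    split_ifs <;> norm_num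
  · exact hi.mono fun q hq => neg_inj.trans hq
  · rw [chartDeriv_neg]
    simpa using hpos

/-- At the top the function increases along the outer normal of the top face, so that one can move
upwards until one hits this face. -/
theorem IsTame.exists_hasUpLiftOn_of_mem_top (hf : IsTame d Xm Xp sm sp f) {p : X} (hp : p ∈ Xp) :
    (∃ U ∈ 𝓝 p, HasUpLiftOn f sp U) ∧ ∃ U ∈ 𝓝 p, HasUpLiftOn (fun x => -f x) (-sm) U := by
  have htop := hf.top_eq
  obtain ⟨i, hi⟩ := hf.isCobordism.face_top p hp
  rw [htop] at hi hp
  obtain ⟨w, hw⟩ := hf.exists_chartDeriv_pos p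
  have hpos := chartDeriv_single_pos hf.contMDiff_neg (fun q => neg_le_neg (hf.mem_Icc q).2)
    (congrArg Neg.neg hp) (hi.mono fun q hq => neg_inj.trans hq)
    (fun h => by rw [chartDeriv_neg, neg_eq_zero] at h; simp [h] at hw)
  refine ⟨exists_hasUpLiftOn_of_wall hf.contMDiff hp hi ?_,
    exists_hasUpLiftOn_of_direction hf.contMDiff_neg (fun j _ => ?_) hpos (-sm)⟩
  · rw [chartDeriv_neg] at hpos
    simpa using hpos
  · rw [PiLp.single_apply]
    split_ifs <;> norm_num

theorem IsTame.exists_hasUpLiftOn_neg_of_direction (hf : IsTame d Xm Xp sm sp f) {p : X}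
    {v : EuclideanSpace ℝ (Fin d)}
    (hv : ∀ i, chartCoord d p i p = 0 → v i ≤ 0)
    (hl : 0 < chartDeriv d f p v) (T : ℝ) : ∃ U ∈ 𝓝 p, HasUpLiftOn (fun x => -f x) T U := by
  refine exists_hasUpLiftOn_of_direction hf.contMDiff_neg (v := -v) (fun i hi => ?_) ?_ T
  · exact neg_nonneg.2 (hv i hi)
  · rw [chartDeriv_neg]
    simpa using hl

/-- Off the side there is nothing in the way of moving upwards and downwards, except for the two
ends. -/
theorem IsTame.exists_hasUpLiftOn_of_notMem_side (hf : IsTame d Xm Xp sm sp f) {p : X}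
    (hp : p ∉ sideBoundary d Xm Xp) :
    (∃ U ∈ 𝓝 p, HasUpLiftOn f sp U) ∧ ∃ U ∈ 𝓝 p, HasUpLiftOn (fun x => -f x) (-sm) U := by
  by_cases hm : p ∈ Xm
  · exact hf.exists_hasUpLiftOn_of_mem_bot hm
  by_cases hp' : p ∈ Xp
  · exact hf.exists_hasUpLiftOn_of_mem_top hp'
  have hpos := chartCoord_pos_of_notMem_boundary
    fun h => hp (subset_closure ⟨h, fun h' => h'.elim hm hp'⟩)
  obtain ⟨v, hv⟩ := hf.exists_chartDeriv_pos p
  exact ⟨exists_hasUpLiftOn_of_direction hf.contMDiff (fun i hi => absurd hi (hpos i).ne') hv sp,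
    hf.exists_hasUpLiftOn_neg_of_direction (fun i hi => absurd hi (hpos i).ne') hv (-sm)⟩

/-- At a regular point of the side one can move along the side. -/
theorem IsTame.exists_hasUpLiftOn_of_not_isCriticalOn (hf : IsTame d Xm Xp sm sp f) {p : X}
    (hp : ¬ IsCriticalOn d (sideBoundary d Xm Xp) f p) :
    (∃ U ∈ 𝓝 p, HasUpLiftOn f sp U) ∧ ∃ U ∈ 𝓝 p, HasUpLiftOn (fun x => -f x) (-sm) U := by
  by_cases hB : p ∉ sideBoundary d Xm Xp
  · exact hf.exists_hasUpLiftOn_of_notMem_side hB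
  rw [not_not] at hB
  by_cases hm : p ∈ Xm
  · exact hf.exists_hasUpLiftOn_of_mem_bot hm
  by_cases hp' : p ∈ Xp
  · exact hf.exists_hasUpLiftOn_of_mem_top hp'
  obtain ⟨i, hi⟩ := hf.isCobordism.face_side p hB
  have hv : ∃ v : EuclideanSpace ℝ (Fin d), v i = 0 ∧ 0 < chartDeriv d f p v := by
    by_contra! hcon
    refine hp ⟨hB, i, hi, fun v hv => ?_⟩
    have h1 := hcon v hv
    have h2 := hcon (-v) (by simp [hv])
    rw [map_neg, neg_nonpos] at h2
    have h3 : chartDeriv d f p v = 0 := le_antisymm h1 h2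
    exact (mfderiv_eq_chartDeriv hf.contMDiff p v).trans h3
  obtain ⟨v, hvi, hv⟩ := hv
  have hv0 : ∀ j, chartCoord d p j p = 0 → v j = 0 := fun j hj => by
    rw [hf.isCobordism.eq_of_chartCoord_eq_zero hm hp' hi hj, hvi]
  exact ⟨exists_hasUpLiftOn_of_direction hf.contMDiff (fun j hj => (hv0 j hj).ge) hv sp,
    hf.exists_hasUpLiftOn_neg_of_direction (fun j hj => (hv0 j hj).le) hv (-sm)⟩

/-- At each point one can move upwards or downwards: a direction of increase or its opposite does
not point out of `X`. -/
theorem IsTame.exists_hasUpLiftOn_or (hf : IsTame d Xm Xp sm sp f) (p : X) :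
    (∃ U ∈ 𝓝 p, HasUpLiftOn f sp U) ∨ ∃ U ∈ 𝓝 p, HasUpLiftOn (fun x => -f x) (-sm) U := by
  by_cases hB : p ∉ sideBoundary d Xm Xp
  · exact Or.inl (hf.exists_hasUpLiftOn_of_notMem_side hB).1
  rw [not_not] at hB
  by_cases hm : p ∈ Xm
  · exact Or.inl (hf.exists_hasUpLiftOn_of_mem_bot hm).1
  by_cases hp' : p ∈ Xp
  · exact Or.inl (hf.exists_hasUpLiftOn_of_mem_top hp').1
  obtain ⟨i, hi⟩ := hf.isCobordism.face_side p hB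
  have hcoord : ∀ j, chartCoord d p j p = 0 → j = i := fun j hj =>
    hf.isCobordism.eq_of_chartCoord_eq_zero hm hp' hi hj
  obtain ⟨v, hv⟩ := hf.exists_chartDeriv_pos p
  rcases le_total 0 (v i) with h | h
  · exact Or.inl (exists_hasUpLiftOn_of_direction hf.contMDiff
      (fun j hj => by rwa [hcoord j hj]) hv sp)
  · exact Or.inr (hf.exists_hasUpLiftOn_neg_of_direction
      (fun j hj => by rwa [hcoord j hj]) hv (-sm))

/-- In a slab with at most one critical point one can move in one of the two directions. -/
theorem IsTame.isLiftable [T2Space X] [CompactSpace X] (hf : IsTame d Xm Xp sm sp f) {n : ℕ}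
    (P : IntervalPartition sm sp n)
    (hP : ∀ i : Fin n,
      {p | IsCriticalOn d (sideBoundary d Xm Xp) f p ∧ f p ∈ P.piece i}.Subsingleton) :
    P.IsLiftable f := by
  intro i
  have hc := hf.contMDiff.continuous
  have hle := (P.strictMono (Fin.castSucc_lt_succ (i := i))).le
  by_cases hup : ∀ p, f p ∈ P.piece i → ∃ U ∈ 𝓝 p, HasUpLiftOn f sp U
  · exact Or.inl (hasLift_upMoves hc hle (P.mem_Icc _).2 hup)
  · push Not at hup
    obtain ⟨p, hp, hpU⟩ := hup
    have hpU' : ¬ ∃ U ∈ 𝓝 p, HasUpLiftOn f sp U := fun ⟨U, hU, hL⟩ => hpU U hU hL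
    have hcrit : IsCriticalOn d (sideBoundary d Xm Xp) f p := by
      by_contra h
      exact hpU' (hf.exists_hasUpLiftOn_of_not_isCriticalOn h).1
    refine Or.inr (hasLift_downMoves hc (P.mem_Icc _).1 hle fun q hq => ?_)
    by_cases hqc : IsCriticalOn d (sideBoundary d Xm Xp) f q
    · rw [hP i ⟨hqc, hq⟩ ⟨hcrit, hp⟩]
      exact (hf.exists_hasUpLiftOn_or p).resolve_left hpU'
    · exact (hf.exists_hasUpLiftOn_of_not_isCriticalOn hqc).2

end TameFunctions

theorem theorem3p1 {d : ℕ} {X : Type u} [TopologicalSpace X] [T2Space X] [CompactSpace X]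
    [ChartedSpace (EuclideanQuadrant d) X]
    [IsManifold (modelWithCornersEuclideanQuadrant d) ∞ X]
    (Xm Xp : Set X) (sm sp : ℝ) (f : X → ℝ) (hf : IsTame d Xm Xp sm sp f)
    {n : ℕ} (P : IntervalPartition sm sp n)
    (hP : ∀ i : Fin n,
      {p | IsCriticalOn d (sideBoundary d Xm Xp) f p ∧ f p ∈ P.piece i}.Subsingleton) :
    Function.Surjective (sectionsToLim f P) ∧
    Function.Surjective (SequentialPath.toLim : SequentialPath f P → LimPiZero f P) ∧
    ∀ γ : SequentialPath f P,
      ∃ (ι : DerivedLim γ.piOne → ZerothHomotopy (SectionSpace f sm sp))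
        (o : DerivedLim γ.piOne ≃ GluingOrbits γ.piOne),
        Function.Injective ι ∧
        range ι = sectionsToLim f P ⁻¹' {γ.toLim} ∧
        (∀ z : LimCocycle γ.piOne, o (DerivedLim.mk γ.piOne z) =
          GluingOrbits.mk γ.piOne (fun i =>
            (z.1 _ _ (Zigzag.right i))⁻¹ * z.1 _ _ (Zigzag.left i))) ∧
        (∀ (σ : SectionSpace f sm sp)
          (q : ∀ i, Path (γ.pt i) ((SequentialPath.ofSection σ : SequentialPath f P).pt i))
          (x : DerivedLim γ.piOne),
          ι x = ZerothHomotopy.mk σ ↔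
            o x = GluingOrbits.mk γ.piOne (γ.difference (SequentialPath.ofSection σ) q)) := by
  have hL := hf.isLiftable P hP
  have hc := hf.contMDiff.continuous
  exact ⟨sectionsToLim_surjective hc hL, SequentialPath.toLim_surjective,
    fun γ => exists_classification hc hL γ⟩
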